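/- **Conventions.** Let $Q=(Q_0,Q_1,\mathfrak s,\mathfrak t)$ be a finite quiver and $k$ a field; the composite of arrows $a,b$ with $\mathfrak t(a)=\mathfrak s(b)$ is written $ab$. Let $(Q,I)$ be a gentle pair: $I$ is an admissible ideal of $kQ$ generated by paths of length two; every vertex is the source of at most two arrows and the target of at most two arrows; and for each arrow $a$ there is at most one arrow $b$ with $\mathfrak t(a)=\mathfrak s(b)$ and $ab\notin I$, at most one such $b$ with $ab\in I$, at most one arrow $c$ with $\mathfrak t(c)=\mathfrak s(a)$ and $ca\notin I$, and at most one such $c$ with $ca\in I$. Put $A=kQ/I$ and consider right $A$-modules. Formal inverses satisfy $\mathfrak s(a^{-1})=\mathfrak t(a)$, $\mathfrak t(a^{-1})=\mathfrak s(a)$, $(a^{-1})^{-1}=a$. A *string* of length $m\ge 1$ is a sequence $\mathbf s=a_1\cdots a_m$ with $a_i\in Q_1\cup Q_1^{-1}$ such that for all $1\le i<m$: $\mathfrak t(a_i)=\mathfrak s(a_{i+1})$; $a_{i+1}\neq a_i^{-1}$; if $a_i,a_{i+1}\in Q_1$ then $a_ia_{i+1}\notin I$; and if $a_i,a_{i+1}\in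 Q_1^{-1}$ then $a_{i+1}^{-1}a_i^{-1}\notin I$. Put $\mathfrak s(\mathbf s)=\mathfrak s(a_1)$ and $\mathfrak t(\mathbf s)=\mathfrak t(a_m)$. The *string module* $\mathbb M(\mathbf s)$ has $k$-basis $z_0,\dots,z_m$, where $z_0$ lies at the vertex $\mathfrak s(a_1)$ and $z_i$ at $\mathfrak t(a_i)$ for $i\ge 1$; an arrow $a$ acts by $z_ia=z_{i+1}$ if $a_{i+1}=a$, by $z_ia=z_{i-1}$ if $a_i=a^{-1}$, and by $z_ia=0$ otherwise. A *forbidden path* (of length $n\ge 1$) is a path $F=f_1\cdots f_n$, $f_i\in Q_1$, with $f_if_{i+1}\in I$ for $1\le i<n$. It is *left maximal* if there is no arrow $\alpha$ with $\mathfrak t(\alpha)=\mathfrak s(f_1)$ and $\alpha f_1\in I$, and *right maximal* if there is no arrow $\alpha$ with $\mathfrak t(f_n)=\mathfrak s(\alpha)$ and $f_n\alpha\in I$. For $x,y\in Q_1\cup Q_1^{-1}$ we say that $x$ and $y$ *meet without relation* if $xy$ is a string of length two. **Proposition.** Let $\mathbf s=a_1\cdots a_m$ $(m\ge 1)$ be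 a string in $(Q,I)$. 1. - (1.1) If $F_1=f_1\cdots f_{u_L}$ $(u_L\ge 1)$ is a left maximal forbidden path with $\mathfrak t(F_1)=\mathfrak s(\mathbf s)$ such that $f_{u_L}$ and $a_1$ meet without relation, then $\operatorname{inj.dim}\mathbb M(\mathbf s)\ge u_L$. - (1.2) If $F_2=g_1\cdots g_{u_R}$ $(u_R\ge 1)$ is a left maximal forbidden path with $\mathfrak t(F_2)=\mathfrak t(\mathbf s)$ such that $a_m$ and $g_{u_R}^{-1}$ meet without relation, then $\operatorname{inj.dim}\mathbb M(\mathbf s)\ge u_R$. - (1.3) If $F_1$ is as in (1.1) and $F_2$ is as in (1.2), then $\operatorname{inj.dim}\mathbb M(\mathbf s)=\max\{u_L,u_R\}$. 2. - (2.1) If $F_1=f_1\cdots f_{d_L}$ $(d_L\ge 1)$ is a right maximal forbidden path with $\mathfrak s(F_1)=\mathfrak s(\mathbf s)$ such that $f_1^{-1}$ and $a_1$ meet without relation, then $\operatorname{proj.dim}\mathbb M(\mathbf s)\ge d_L$. - (2.2) If $F_2=g_1\cdots g_{d_R}$ $(d_R\ge 1)$ is a right maximal forbidden path with $\mathfrak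 s(F_2)=\mathfrak t(\mathbf s)$ such that $a_m$ and $g_1$ meet without relation, then $\operatorname{proj.dim}\mathbb M(\mathbf s)\ge d_R$. - (2.3) If $F_1$ is as in (2.1) and $F_2$ is as in (2.2), then $\operatorname{proj.dim}\mathbb M(\mathbf s)=\max\{d_L,d_R\}$. -/

import Mathlib

open CategoryTheory

universe u

noncomputable section

namespace GentleString

open scoped Classical

/-! ### The path algebra of a finite quiver

Paths are composed from left to right: `ab` is the path "first `a`, then `b`", defined when the
target of `a` is the source of `b`. -/

/-- A path of the quiver `V`, together with its source and target. -/
structure QPath (V : Type u) [Quiver.{u} V] : Type u where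
  src : V
  tgt : V
  path : Quiver.Path src tgt

namespace QPath

variable {V : Type u} [Quiver.{u} V]

/-- The path of length zero at the vertex `v`. -/
def nil (v : V) : QPath V := ⟨v, v, Quiver.Path.nil⟩

/-- The number of arrows of a path. -/
def length (p : QPath V) : ℕ := p.path.length

/-- Concatenation of two composable paths. -/
def comp (p q : QPath V) (h : p.tgt = q.src) : QPath V :=
  ⟨p.src, q.tgt, p.path.comp (q.path.cast h.symm rfl)⟩

end QPath

/-- The path algebra `kQ`: the `k`-vector space with basis all paths of the quiver. -/
def PathAlgebra (k V : Type u) [Field k] [Quiver.{u} V] : Type u := QPath V →₀ k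

namespace PathAlgebra

variable (k : Type u) {V : Type u} [Field k] [Quiver.{u} V]

instance : AddCommGroup (PathAlgebra k V) := inferInstanceAs (AddCommGroup (QPath V →₀ k))

instance : Module k (PathAlgebra k V) := inferInstanceAs (Module k (QPath V →₀ k))

/-- A path as a basis element of the path algebra. -/
def ofPath (p : QPath V) : PathAlgebra k V := Finsupp.single p (1 : k)

/-- The product of two paths: their concatenation if they are composable, and zero otherwise. -/
def pathMul (p q : QPath V) : PathAlgebra k V :=
  if h : p.tgt = q.src then ofPath k (p.comp q h) else 0

/-- Linear extension of a map defined on paths. -/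
def extend {M : Type*} [AddCommGroup M] [Module k M] (f : QPath V → M) :
    PathAlgebra k V →ₗ[k] M :=
  Finsupp.linearCombination k f

variable {k}

@[simp] lemma extend_ofPath {M : Type*} [AddCommGroup M] [Module k M] (f : QPath V → M)
    (p : QPath V) : extend k f (ofPath k p) = f p :=
  (Finsupp.linearCombination_single (v := f) k (1 : k) p).trans (one_smul k _)

lemma hom_ext {M : Type*} [AddCommGroup M] [Module k M] {f g : PathAlgebra k V →ₗ[k] M}
    (h : ∀ p, f (ofPath k p) = g (ofPath k p)) : f = g :=
  Finsupp.lhom_ext' (M := k) fun p => LinearMap.ext_ring (h p)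

variable (k V)

/-- The bilinear extension of the product of paths. -/
def mulHom : PathAlgebra k V →ₗ[k] PathAlgebra k V →ₗ[k] PathAlgebra k V :=
  extend k fun p => extend k fun q => pathMul k p q

variable {k V}

instance : Mul (PathAlgebra k V) := ⟨fun x y => mulHom k V x y⟩

lemma mul_def (x y : PathAlgebra k V) : x * y = mulHom k V x y := rfl

lemma ofPath_mul_ofPath (p q : QPath V) : ofPath k p * ofPath k q = pathMul k p q := by
  simp [mul_def, mulHom]

lemma pathMul_assoc (p q r : QPath V) :
    pathMul k p q * ofPath k r = ofPath k p * pathMul k q r := by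
  have hz (x : PathAlgebra k V) : 0 * x = 0 := by simp [mul_def]
  have hz' (x : PathAlgebra k V) : x * 0 = 0 := by simp [mul_def]
  obtain ⟨a, b, p⟩ := p
  obtain ⟨c, d, q⟩ := q
  obtain ⟨e, f, r⟩ := r
  by_cases h : b = c <;> by_cases h' : d = e
  · subst h; subst h'
    simp [pathMul, QPath.comp, ofPath_mul_ofPath]
  · subst h
    simp [pathMul, QPath.comp, ofPath_mul_ofPath, h', hz']
  · subst h'
    simp [pathMul, QPath.comp, ofPath_mul_ofPath, h, hz]
  · simp [pathMul, h, h', hz, hz']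

protected lemma mul_assoc (x y z : PathAlgebra k V) : x * y * z = x * (y * z) := by
  have h1 (p q : QPath V) : mulHom k V (ofPath k p * ofPath k q) =
      (mulHom k V (ofPath k p)) ∘ₗ (mulHom k V (ofPath k q)) := by
    refine hom_ext fun r => ?_
    have h := pathMul_assoc (k := k) p q r
    rwa [← ofPath_mul_ofPath, ← ofPath_mul_ofPath] at h
  have h2 (p : QPath V) : (mulHom k V).flip z ∘ₗ mulHom k V (ofPath k p) =
      mulHom k V (ofPath k p) ∘ₗ (mulHom k V).flip z :=
    hom_ext fun q => LinearMap.congr_fun (h1 p q) z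
  have h3 : (mulHom k V).flip z ∘ₗ (mulHom k V).flip y = (mulHom k V).flip (y * z) :=
    hom_ext fun p => LinearMap.congr_fun (h2 p) y
  exact LinearMap.congr_fun h3 x

variable [Fintype V]

instance : One (PathAlgebra k V) := ⟨∑ v, ofPath k (QPath.nil v)⟩

lemma one_def : (1 : PathAlgebra k V) = ∑ v, ofPath k (QPath.nil v) := rfl

lemma one_mul_ofPath (p : QPath V) : (1 : PathAlgebra k V) * ofPath k p = ofPath k p := by
  obtain ⟨a, b, p⟩ := p
  rw [one_def, mul_def, map_sum, LinearMap.sum_apply, Finset.sum_eq_single a]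
  · rw [← mul_def, ofPath_mul_ofPath]
    simp [pathMul, QPath.nil, QPath.comp]
  · intro v _ hv
    rw [← mul_def, ofPath_mul_ofPath]
    simp [pathMul, QPath.nil, hv]
  · simp

lemma ofPath_mul_one (p : QPath V) : ofPath k p * (1 : PathAlgebra k V) = ofPath k p := by
  obtain ⟨a, b, p⟩ := p
  rw [one_def, mul_def, map_sum, Finset.sum_eq_single b]
  · rw [← mul_def, ofPath_mul_ofPath]
    simp [pathMul, QPath.nil, QPath.comp]
  · intro v _ hv
    rw [← mul_def, ofPath_mul_ofPath]
    simp [pathMul, QPath.nil, Ne.symm hv]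
  · simp

instance : Ring (PathAlgebra k V) :=
  { (inferInstance : AddCommGroup (PathAlgebra k V)) with
    mul := (· * ·)
    one := 1
    left_distrib := fun x y z => by simp [mul_def]
    right_distrib := fun x y z => by simp [mul_def]
    zero_mul := fun x => by simp [mul_def]
    mul_zero := fun x => by simp [mul_def]
    mul_assoc := PathAlgebra.mul_assoc
    one_mul := fun x => LinearMap.congr_fun
      (hom_ext one_mul_ofPath : mulHom k V 1 = LinearMap.id) x
    mul_one := fun x => LinearMap.congr_fun
      (hom_ext ofPath_mul_one : (mulHom k V).flip 1 = LinearMap.id) x }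

instance : Algebra k (PathAlgebra k V) :=
  Algebra.ofModule (fun r x y => by simp [mul_def]) (fun r x y => by simp [mul_def])

end PathAlgebra

/-! ### Gentle pairs -/

section Gentle

set_option linter.unusedSectionVars false

open Quiver (Total)

variable {k V : Type u} [Field k] [Quiver.{u} V]

/-- An arrow as a path of length one. -/
def arrowPath (a : Total V) : QPath V := ⟨a.left, a.right, a.hom.toPath⟩

variable (k) in
/-- An arrow as an element of the path algebra. -/
def arrow (a : Total V) : PathAlgebra k V := PathAlgebra.ofPath k (arrowPath a)

variable [Fintype V] (I : TwoSidedIdeal (PathAlgebra k V))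

/-- The arrows `a`, `b` are composable and `ab ∈ I`. -/
def IsRelation (a b : Total V) : Prop := a.right = b.left ∧ arrow k a * arrow k b ∈ I

/-- The arrows `a`, `b` are composable and `ab ∉ I`. -/
def IsNonRelation (a b : Total V) : Prop := a.right = b.left ∧ arrow k a * arrow k b ∉ I

/-- `I` is admissible: with `J` the arrow ideal, `J ^ N ≤ I ≤ J ^ 2` for some `N ≥ 2`. Here `J ^ n`
is the span of the paths of length at least `n`. -/
def IsAdmissible : Prop :=
  (∃ N : ℕ, 2 ≤ N ∧ ∀ p : QPath V, N ≤ p.length → PathAlgebra.ofPath k p ∈ I) ∧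
    ∀ x ∈ I, x ∈ Submodule.span k
      {y : PathAlgebra k V | ∃ p : QPath V, 2 ≤ p.length ∧ y = PathAlgebra.ofPath k p}

/-- `(Q, I)` is a gentle pair. -/
structure IsGentlePair : Prop where
  admissible : IsAdmissible I
  out_le_two : ∀ v : V, {a : Total V | a.left = v}.encard ≤ 2
  in_le_two : ∀ v : V, {a : Total V | a.right = v}.encard ≤ 2
  nonRelation_right : ∀ a b b' : Total V, IsNonRelation I a b → IsNonRelation I a b' → b = b'
  nonRelation_left : ∀ a c c' : Total V, IsNonRelation I c a → IsNonRelation I c' a → c = c'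
  relation_right : ∀ a b b' : Total V, IsRelation I a b → IsRelation I a b' → b = b'
  relation_left : ∀ a c c' : Total V, IsRelation I c a → IsRelation I c' a → c = c'
  generated : ∃ S : Set (Total V × Total V), (∀ x ∈ S, x.1.right = x.2.left) ∧
    I = TwoSidedIdeal.span ((fun x => arrow k x.1 * arrow k x.2) '' S)

/-- The bound path algebra `A = kQ/I`. -/
abbrev BoundAlgebra : Type u := I.ringCon.Quotient

/-- The category of right modules over `A = kQ/I`. -/
abbrev RightMod : Type (u + 1) := ModuleCat.{u} (BoundAlgebra I)ᵐᵒᵖ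

/-! ### Strings -/

/-- An arrow `a` or a formal inverse `a⁻¹` of an arrow. -/
inductive Letter (V : Type u) [Quiver.{u} V] : Type u
  | pos (a : Total V) : Letter V
  | neg (a : Total V) : Letter V

namespace Letter

/-- The source of a letter. -/
def src : Letter V → V
  | pos a => a.left
  | neg a => a.right

/-- The target of a letter. -/
def tgt : Letter V → V
  | pos a => a.right
  | neg a => a.left

/-- The formal inverse of a letter. -/
def inv : Letter V → Letter V
  | pos a => neg a
  | neg a => pos a

end Letter

/-- The path `a₁ ⋯ aₙ` as a sequence of letters. -/
def directWord (F : List (Total V)) : List (Letter V) := F.map Letter.pos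

/-- The formal inverse `aₙ⁻¹ ⋯ a₁⁻¹` of the path `a₁ ⋯ aₙ`. -/
def inverseWord (F : List (Total V)) : List (Letter V) := (F.map Letter.neg).reverse

/-- The letters `x`, `y` do not form a relation: if both are arrows then `xy ∉ I`, and if both are
formal inverses then `y⁻¹x⁻¹ ∉ I`. -/
def NoRelation : Letter V → Letter V → Prop
  | .pos a, .pos b => arrow k a * arrow k b ∉ I
  | .neg a, .neg b => arrow k b * arrow k a ∉ I
  | _, _ => True

/-- `xy` is a string of length two. -/
def IsStep (x y : Letter V) : Prop := x.tgt = y.src ∧ NoRelation I x y ∧ y ≠ x.inv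

/-- A string `a₁ ⋯ aₘ` of length `m ≥ 1` in the gentle pair `(Q, I)`. -/
structure GString where
  letters : List (Letter V)
  ne_nil : letters ≠ []
  isChain : letters.IsChain (IsStep I)

/-- The vertex at which the words `w` and `w'` are joined is a vertex without relation on the
concatenation `w w'`: the last letter of `w` followed by the first letter of `w'` is a string of
length two (in particular, `w` ends where `w'` starts). -/
def JoinedWithoutRelation (w w' : List (Letter V)) : Prop :=
  ∃ x ∈ w.getLast?, ∃ y ∈ w'.head?, IsStep I x y

/-! ### Forbidden paths -/

/-- A forbidden path `a₁ ⋯ aₙ` of length `n ≥ 1`: a path with `aᵢaᵢ₊₁ ∈ I` for all `1 ≤ i < n`. -/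
def IsForbiddenPath (F : List (Total V)) : Prop := F ≠ [] ∧ F.IsChain (IsRelation I)

/-- A left maximal forbidden path: no arrow `α` ending at its source satisfies `αa₁ ∈ I`. -/
def IsLeftMaximalForbidden (F : List (Total V)) : Prop :=
  IsForbiddenPath I F ∧ ¬ ∃ α : Total V, ∃ a ∈ F.head?, IsRelation I α a

/-- A right maximal forbidden path: no arrow `α` starting at its target satisfies `aₙα ∈ I`. -/
def IsRightMaximalForbidden (F : List (Total V)) : Prop :=
  IsForbiddenPath I F ∧ ¬ ∃ α : Total V, ∃ a ∈ F.getLast?, IsRelation I a α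

/-! ### String modules

For a string `a₁ ⋯ aₘ` visiting the vertices `v₀, …, vₘ`, the string module is the right `A`-module
with `k`-basis `z₀, …, zₘ`, where `zᵢ` lies at the vertex `vᵢ`, and an arrow `a` acts by
`zᵢ a = zᵢ₊₁` if `aᵢ₊₁ = a`, by `zᵢ a = zᵢ₋₁` if `aᵢ = a⁻¹`, and by `zᵢ a = 0` otherwise. -/

/-- The `i`-th vertex `vᵢ` of a walk, for `0 ≤ i ≤ m` (and `none` for the other `i`). Note that
`w[i]?` is the letter `aᵢ₊₁`. -/
def vertexAt (w : List (Letter V)) : ℕ → Option V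
  | 0 => w[0]?.map Letter.src
  | i + 1 => w[i]?.map Letter.tgt

/-- The arrow `a` sends the basis vector `zᵢ` to `zⱼ`. -/
def Moves (w : List (Letter V)) (a : Total V) (i j : ℕ) : Prop :=
  (j = i + 1 ∧ w[i]? = some (Letter.pos a)) ∨ (i = j + 1 ∧ w[j]? = some (Letter.neg a))

variable (k) in
/-- The vector space with basis `z₀, …, zₘ`. -/
abbrev StringSpace (w : List (Letter V)) : Type u := Fin (w.length + 1) →₀ k

variable (k) in
/-- The right action of the trivial path at `v`. -/
def vertexOp (w : List (Letter V)) (v : V) : Module.End k (StringSpace k w) :=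
  Finsupp.linearCombination k fun i : Fin (w.length + 1) =>
    if vertexAt w i = some v then Finsupp.single i (1 : k) else 0

variable (k) in
/-- The right action of the arrow `a`. -/
def arrowOp (w : List (Letter V)) (a : Total V) : Module.End k (StringSpace k w) :=
  Finsupp.linearCombination k fun i : Fin (w.length + 1) =>
    ∑ j : Fin (w.length + 1), if Moves w a i j then Finsupp.single j (1 : k) else 0

variable (k) in
/-- The right action of a path: the arrows of the path act one after the other. -/
def pathOp (w : List (Letter V)) {u : V} :
    ∀ {v : V}, Quiver.Path u v → Module.End k (StringSpace k w)
  | _, .nil => vertexOp k w u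
  | _, .cons p e => arrowOp k w ⟨_, _, e⟩ * pathOp w p

lemma vertexOp_single (w : List (Letter V)) (v : V) (i : Fin (w.length + 1)) :
    vertexOp k w v (Finsupp.single i 1) =
      if vertexAt w i = some v then Finsupp.single i 1 else 0 := by
  simp [vertexOp]

lemma arrowOp_single (w : List (Letter V)) (a : Total V) (i : Fin (w.length + 1)) :
    arrowOp k w a (Finsupp.single i 1) =
      ∑ j : Fin (w.length + 1), if Moves w a i j then Finsupp.single j 1 else 0 := by
  simp [arrowOp]

lemma vertexAt_isSome {w : List (Letter V)} (hw : w ≠ []) (i : Fin (w.length + 1)) :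
    ∃ v, vertexAt w i = some v := by
  obtain ⟨i, hi⟩ := i
  cases i with
  | zero =>
    have : 0 < w.length := List.length_pos_iff.mpr hw
    exact ⟨w[0].src, by simp [vertexAt, List.getElem?_eq_getElem this]⟩
  | succ i =>
    have : i < w.length := by omega
    exact ⟨w[i].tgt, by simp [vertexAt, List.getElem?_eq_getElem this]⟩

namespace GString

variable {I} (s : GString I)

lemma step {i : ℕ} {x y : Letter V} (hx : s.letters[i]? = some x)
    (hy : s.letters[i + 1]? = some y) : IsStep I x y := by
  obtain ⟨h1, rfl⟩ := List.getElem?_eq_some_iff.mp hx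
  obtain ⟨h2, rfl⟩ := List.getElem?_eq_some_iff.mp hy
  exact List.isChain_iff_getElem.mp s.isChain i h2

lemma vertexAt_src {i : ℕ} {x : Letter V} (hx : s.letters[i]? = some x) :
    vertexAt s.letters i = some x.src := by
  cases i with
  | zero => simp [vertexAt, hx]
  | succ i =>
    obtain ⟨h, -⟩ := List.getElem?_eq_some_iff.mp hx
    have hi : s.letters[i]? = some s.letters[i] := List.getElem?_eq_getElem (by omega)
    simp [vertexAt, hi, (s.step hi hx).1]

lemma vertexAt_tgt {i : ℕ} {x : Letter V} (hx : s.letters[i]? = some x) :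
    vertexAt s.letters (i + 1) = some x.tgt := by
  simp [vertexAt, hx]

lemma moves_vertexAt {a : Total V} {i j : ℕ} (h : Moves s.letters a i j) :
    vertexAt s.letters i = some a.left ∧ vertexAt s.letters j = some a.right := by
  rcases h with ⟨rfl, h⟩ | ⟨rfl, h⟩
  · exact ⟨s.vertexAt_src h, s.vertexAt_tgt h⟩
  · exact ⟨s.vertexAt_tgt h, s.vertexAt_src h⟩

lemma vertexOp_mul_arrowOp (v : V) (a : Total V) :
    vertexOp k s.letters v * arrowOp k s.letters a =
      if a.right = v then arrowOp k s.letters a else 0 := by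
  refine Finsupp.lhom_ext' fun i => LinearMap.ext_ring ?_
  simp only [LinearMap.comp_apply, Finsupp.lsingle_apply, Module.End.mul_apply, arrowOp_single,
    map_sum]
  split_ifs with h
  · rw [arrowOp_single]
    refine Finset.sum_congr rfl fun j _ => ?_
    split_ifs with hm
    · rw [vertexOp_single, if_pos (by rw [(s.moves_vertexAt hm).2, h])]
    · simp
  · rw [LinearMap.zero_apply]
    refine Finset.sum_eq_zero fun j _ => ?_
    split_ifs with hm
    · rw [vertexOp_single, if_neg]
      rw [(s.moves_vertexAt hm).2]
      simpa using h
    · simp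

lemma vertexOp_mul_vertexOp (v u : V) :
    vertexOp k s.letters v * vertexOp k s.letters u =
      if u = v then vertexOp k s.letters u else 0 := by
  refine Finsupp.lhom_ext' fun i => LinearMap.ext_ring ?_
  obtain ⟨t, ht⟩ := vertexAt_isSome s.ne_nil i
  simp only [LinearMap.comp_apply, Finsupp.lsingle_apply, Module.End.mul_apply, vertexOp_single,
    ht, Option.some.injEq]
  by_cases h1 : t = u <;> by_cases h2 : u = v <;>
    simp_all [vertexOp_single]

lemma arrowOp_mul_vertexOp (a : Total V) :
    arrowOp k s.letters a * vertexOp k s.letters a.left = arrowOp k s.letters a := by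
  refine Finsupp.lhom_ext' fun i => LinearMap.ext_ring ?_
  simp only [LinearMap.comp_apply, Finsupp.lsingle_apply, Module.End.mul_apply, vertexOp_single]
  split_ifs with h
  · rfl
  · rw [map_zero, arrowOp_single]
    refine (Finset.sum_eq_zero fun j _ => if_neg fun hm => h (s.moves_vertexAt hm).1).symm

lemma vertexOp_mul_pathOp (w : V) {u v : V} (p : Quiver.Path u v) :
    vertexOp k s.letters w * pathOp k s.letters p =
      if v = w then pathOp k s.letters p else 0 := by
  cases p with
  | nil => exact s.vertexOp_mul_vertexOp w u
  | cons p e =>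
    rw [pathOp, ← mul_assoc, s.vertexOp_mul_arrowOp]
    split_ifs <;> simp

lemma pathOp_mul_pathOp_of_ne {u v v' w : V} (p : Quiver.Path u v) (q : Quiver.Path v' w)
    (h : v ≠ v') : pathOp k s.letters q * pathOp k s.letters p = 0 := by
  induction q with
  | nil => rw [pathOp, s.vertexOp_mul_pathOp, if_neg h]
  | cons q e ih => rw [pathOp, mul_assoc, ih, mul_zero]

lemma pathOp_comp {u v w : V} (p : Quiver.Path u v) (q : Quiver.Path v w) :
    pathOp k s.letters (p.comp q) = pathOp k s.letters q * pathOp k s.letters p := by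
  induction q with
  | nil => rw [pathOp, s.vertexOp_mul_pathOp, if_pos rfl]; rfl
  | cons q e ih => rw [Quiver.Path.comp_cons, pathOp, pathOp, ih, mul_assoc]

lemma sum_vertexOp : ∑ v : V, vertexOp k s.letters v = 1 := by
  refine Finsupp.lhom_ext' fun i => LinearMap.ext_ring ?_
  obtain ⟨t, ht⟩ := vertexAt_isSome s.ne_nil i
  simp [vertexOp_single, ht]

/-- The right action of the path algebra on the space with basis `z₀, …, zₘ`. -/
def pathAlgebraOp : PathAlgebra k V →ₗ[k] Module.End k (StringSpace k s.letters) :=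
  PathAlgebra.extend k fun p => pathOp k s.letters p.path

lemma pathAlgebraOp_mul (x y : PathAlgebra k V) :
    s.pathAlgebraOp (x * y) = s.pathAlgebraOp y * s.pathAlgebraOp x := by
  have h1 (p : QPath V) : s.pathAlgebraOp ∘ₗ PathAlgebra.mulHom k V (PathAlgebra.ofPath k p) =
      (LinearMap.mul k (Module.End k (StringSpace k s.letters))).flip
        (s.pathAlgebraOp (PathAlgebra.ofPath k p)) ∘ₗ s.pathAlgebraOp := by
    refine PathAlgebra.hom_ext (k := k) (M := Module.End k (StringSpace k s.letters)) fun q => ?_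
    rw [LinearMap.comp_apply, ← PathAlgebra.mul_def, PathAlgebra.ofPath_mul_ofPath]
    obtain ⟨a, b, p⟩ := p
    obtain ⟨c, d, q⟩ := q
    by_cases h : b = c
    · subst h
      simp [PathAlgebra.pathMul, pathAlgebraOp, QPath.comp, pathOp_comp]
    · simp [PathAlgebra.pathMul, pathAlgebraOp, h, s.pathOp_mul_pathOp_of_ne p q h]
  have h2 : s.pathAlgebraOp ∘ₗ (PathAlgebra.mulHom k V).flip y =
      LinearMap.mul k (Module.End k (StringSpace k s.letters)) (s.pathAlgebraOp y) ∘ₗ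
        s.pathAlgebraOp :=
    PathAlgebra.hom_ext (k := k) (M := Module.End k (StringSpace k s.letters))
      fun p => LinearMap.congr_fun (h1 p) y
  exact LinearMap.congr_fun h2 x

lemma pathAlgebraOp_one : s.pathAlgebraOp (1 : PathAlgebra k V) = 1 := by
  rw [PathAlgebra.one_def, map_sum, ← s.sum_vertexOp]
  exact Finset.sum_congr rfl fun v _ => by simp [pathAlgebraOp, QPath.nil, pathOp]

/-- The right action of the path algebra, as a ring homomorphism. -/
def pathAlgebraHom : PathAlgebra k V →+* (Module.End k (StringSpace k s.letters))ᵐᵒᵖ where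
  toFun x := MulOpposite.op (s.pathAlgebraOp x)
  map_one' := by rw [pathAlgebraOp_one]; rfl
  map_mul' x y := by rw [pathAlgebraOp_mul]; rfl
  map_zero' := by simp
  map_add' x y := by simp

lemma pathAlgebraOp_relation {a b : Total V} (h : IsRelation I a b) :
    s.pathAlgebraOp (arrow k a * arrow k b) = 0 := by
  have h1 (c : Total V) : s.pathAlgebraOp (arrow k c) = arrowOp k s.letters c := by
    simp only [arrow, pathAlgebraOp, PathAlgebra.extend_ofPath]
    exact s.arrowOp_mul_vertexOp c
  rw [pathAlgebraOp_mul, h1, h1]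
  refine Finsupp.lhom_ext' fun i => LinearMap.ext_ring ?_
  simp only [LinearMap.comp_apply, Finsupp.lsingle_apply, Module.End.mul_apply, arrowOp_single,
    map_sum, LinearMap.zero_apply]
  refine Finset.sum_eq_zero fun j _ => ?_
  split_ifs with hij
  · rw [arrowOp_single]
    refine Finset.sum_eq_zero fun l _ => if_neg fun hjl => ?_
    rcases hij with ⟨e, hi⟩ | ⟨e, hi⟩ <;> rcases hjl with ⟨e', hj⟩ | ⟨e', hj⟩
    · rw [e] at hj
      exact (s.step hi hj).2.1 h.2
    · rw [show (l : ℕ) = i by omega] at hj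
      simp [hi] at hj
    · simp [hi] at hj
    · rw [e'] at hi
      exact (s.step hj hi).2.1 h.2
  · simp

lemma ringCon_le_ker (hI : IsGentlePair I) : I.ringCon ≤ RingCon.ker s.pathAlgebraHom := by
  obtain ⟨S, hS, hIS⟩ := hI.generated
  have h : I ≤ TwoSidedIdeal.ker s.pathAlgebraHom := by
    conv_lhs => rw [hIS]
    refine TwoSidedIdeal.span_le.mpr ?_
    rintro _ ⟨x, hx, rfl⟩
    have hmem : arrow k x.1 * arrow k x.2 ∈ I := by
      conv => arg 1; rw [hIS]
      exact TwoSidedIdeal.subset_span ⟨x, hx, rfl⟩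
    have := s.pathAlgebraOp_relation ⟨hS x hx, hmem⟩
    simp [TwoSidedIdeal.mem_ker, pathAlgebraHom, this]
  intro x y hxy
  have h' := h ((TwoSidedIdeal.rel_iff I x y).mp hxy)
  rw [TwoSidedIdeal.mem_ker, map_sub, sub_eq_zero] at h'
  exact h'

/-- The right action of `A = kQ/I` on the space with basis `z₀, …, zₘ`. -/
def actionHom (hI : IsGentlePair I) :
    (BoundAlgebra I)ᵐᵒᵖ →+* Module.End k (StringSpace k s.letters) :=
  (RingEquiv.opOp (Module.End k (StringSpace k s.letters))).symm.toRingHom.comp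
    (RingHom.op (I.ringCon.lift s.pathAlgebraHom (s.ringCon_le_ker hI)))

/-- The string module `M(s)`, a right `A`-module. -/
def stringModule (hI : IsGentlePair I) : RightMod I :=
  letI : Module (BoundAlgebra I)ᵐᵒᵖ (StringSpace k s.letters) :=
    Module.compHom _ (s.actionHom hI)
  ModuleCat.of (BoundAlgebra I)ᵐᵒᵖ (StringSpace k s.letters)

end GString

end Gentle

end GentleString

end

noncomputable section

namespace GentleString

open scoped Classical

open Quiver (Total)

/-! ### Quadratic monomial rings -/

/-! Right modules over the bound algebra are left modules over its opposite, in which multiplication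
by an arrow is the right action of that arrow. For an arrow a there is at most one b with ba ∈ I,
and `ExactAt` says that the sequence "act by b, then by a" is exact in the middle; in homological
terms it is the vanishing of Tor₁ against Ae/Aa, with e the idempotent at the target of a.
`CoexactAt` is the dual condition. Both hold for all arrows on projective, respectively injective,
modules. Conversely, exactness at all arrows together with `IndepImages` forces projectivity, and
coexactness together with `JointImages` forces injectivity.

These conditions shift along relations: if ab ∈ I, exactness of a syzygy at b amounts to exactness
of the module at a. Hence a failure of exactness at a, followed by n relations a a₁, a₁a₂, …, forces
projective dimension greater than n. If every failure starts only chains with fewer than n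
relations, n ≥ 1, then the dimension is at most n. The auxiliary condition costs nothing from the
first syzygy on, because `IndepImages` passes to submodules and `JointImages` to quotients.

On a string module everything can be read from the basis: exactness at a fails precisely when a⁻¹
can be attached to an end of the string, and coexactness precisely when a can. At each end the
gentle axioms allow at most one such arrow, namely the one belonging to the given forbidden path,
and the chain of relations from that arrow must follow the path. A maximal forbidden path with n
arrows has n - 1 relations and no continuation, so it gives exactly n.

The algebraic input (`monomialRing`) is that stripping an arrow from an element of I leaves an
element of I plus a multiple of the arrow forming a relation with it. The gluing is done by
`projective_of_exactAt`, `injective_of_coexactAt`, the syzygy lemmas, and the four (co)exactness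
theorems on string modules. -/

/-- A ring `R` generated over a field `k` by idempotents `e v` and arrows `x a` in the way in which
the opposite of a finite-dimensional gentle algebra is: `x b * x a` is the path "first `a`, then
`b`", which is a relation if `rel a b` holds, and the nonzero paths are linearly independent. -/
structure MonomialRing (k R V Arr : Type*) [Field k] [Ring R] [Algebra k R] [Fintype V]
    [Fintype Arr] where
  src : Arr → V
  tgt : Arr → V
  e : V → R
  x : Arr → R
  rel : Arr → Arr → Prop
  e_mul_self : ∀ v, e v * e v = e v
  e_mul_e : ∀ v w, v ≠ w → e v * e w = 0
  sum_e : ∑ v, e v = 1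
  x_mul_e : ∀ a, x a * e (src a) = x a
  e_mul_x : ∀ a, e (tgt a) * x a = x a
  rel_vertex : ∀ {a b}, rel a b → tgt a = src b
  rel_mul : ∀ {a b}, rel a b → x b * x a = 0
  rel_left_unique : ∀ {a b c}, rel a c → rel b c → a = b
  rel_right_unique : ∀ {a b c}, rel a b → rel a c → b = c
  nilpotent : ∃ N : ℕ, ∀ l : List Arr, l.length = N → (l.map x).prod = 0
  decomp_left : ∀ r, ∃ (c : V → k) (y : Arr → R), r = ∑ v, c v • e v + ∑ a, y a * x a
  decomp_right : ∀ r, ∃ (c : V → k) (y : Arr → R), r = ∑ v, c v • e v + ∑ a, x a * y a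
  exact_left : ∀ a r, e (src a) * r = r → x a * r = 0 → r = 0 ∨ ∃ b, rel b a ∧ ∃ y, r = x b * y
  indep_left : ∀ y : Arr → R, ∑ a, x a * y a = 0 → ∀ a, x a * y a = 0
  exact_right : ∀ a r, r * e (tgt a) = r → r * x a = 0 → r = 0 ∨ ∃ b, rel a b ∧ ∃ y, r = y * x b
  indep_right : ∀ y : Arr → R, ∑ a, y a * x a = 0 → ∀ a, y a * x a = 0

namespace MonomialRing

variable {k R V Arr : Type*} [Field k] [Ring R] [Algebra k R] [Fintype V] [Fintype Arr]
variable (S : MonomialRing k R V Arr)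

lemma x_mul_e_of_ne {a : Arr} {v : V} (h : S.src a ≠ v) : S.x a * S.e v = 0 := by
  rw [← S.x_mul_e a, mul_assoc, S.e_mul_e _ _ h, mul_zero]

/-! ### Exactness conditions on modules over a monomial ring -/

section Modules

variable (N : Type*) [AddCommGroup N] [Module R N]

/-- The kernel of `a` at its source is the image of the arrow which forms a relation with `a`. -/
def ExactAt (a : Arr) : Prop :=
  ∀ n : N, S.e (S.src a) • n = n → S.x a • n = 0 → n = 0 ∨ ∃ b, S.rel b a ∧ ∃ y : N, n = S.x b • y

/-- The image of `a` is the kernel at the target of `a` of the arrow with which `a` forms a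
relation. -/
def CoexactAt (a : Arr) : Prop :=
  ∀ n : N, S.e (S.tgt a) • n = n → (∀ b, S.rel a b → S.x b • n = 0) → ∃ y : N, n = S.x a • y

/-- The images of the arrows are linearly independent. -/
def IndepImages : Prop :=
  ∀ y : Arr → N, ∑ a, S.x a • y a = 0 → ∀ a, S.x a • y a = 0

/-- Elements of the images of the arrows can be lifted simultaneously. -/
def JointImages : Prop :=
  ∀ y : Arr → N, ∃ c : N, ∀ a, S.x a • c = S.x a • y a

end Modules

section

variable {N : Type*} [AddCommGroup N] [Module R N]

lemma x_smul_e_smul (a : Arr) (n : N) : S.x a • S.e (S.src a) • n = S.x a • n := by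
  rw [← mul_smul, S.x_mul_e]

lemma e_smul_x_smul (a : Arr) (n : N) : S.e (S.tgt a) • S.x a • n = S.x a • n := by
  rw [← mul_smul, S.e_mul_x]

lemma e_smul_e_smul (v : V) (n : N) : S.e v • S.e v • n = S.e v • n := by
  rw [← mul_smul, S.e_mul_self]

lemma rel_smul {a b : Arr} (h : S.rel a b) (n : N) : S.x b • S.x a • n = 0 := by
  rw [← mul_smul, S.rel_mul h, zero_smul]

lemma sum_e_smul (n : N) : ∑ v, S.e v • n = n := by
  rw [← Finset.sum_smul, S.sum_e, one_smul]

/-- A module which equals its radical is zero. -/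
lemma eq_zero_of_radical_eq (T : Set N) (h : ∀ n ∈ T, ∃ y : Arr → N, (∀ a, y a ∈ T) ∧
    n = ∑ a, S.x a • y a) {n : N} (hn : n ∈ T) : n = 0 := by
  obtain ⟨m, hm⟩ := S.nilpotent
  have key : ∀ (j : ℕ) (n : N), n ∈ T → ∀ l : List Arr, j + l.length = m →
      (l.map S.x).prod • n = 0 := by
    intro j
    induction j with
    | zero => intro n _ l hl; rw [hm l (by omega), zero_smul]
    | succ j ih =>
      intro n hn l hl
      obtain ⟨y, hy, rfl⟩ := h n hn
      rw [Finset.smul_sum]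
      refine Finset.sum_eq_zero fun a _ => ?_
      have := ih (y a) (hy a) (l ++ [a]) (by simp; omega)
      simpa [mul_smul] using this
  simpa using key m n hn [] (by simp)

/-- Outside a proper submodule there is an element which all arrows send into the submodule. -/
lemma exists_notMem_forall_smul_mem (D : Submodule R N) {n : N} (hn : n ∉ D) :
    ∃ (v : V) (y : N), S.e v • y = y ∧ y ∉ D ∧ ∀ a, S.x a • y ∈ D := by
  obtain ⟨m, hm⟩ := S.nilpotent
  have key : ∀ (j : ℕ) (n : N), n ∉ D → (∀ l : List Arr, l.length = j → (l.map S.x).prod • n ∈ D) →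
      ∃ y : N, y ∉ D ∧ ∀ a, S.x a • y ∈ D := by
    intro j
    induction j with
    | zero => intro n hn h; exact absurd (by simpa using h [] rfl) hn
    | succ j ih =>
      intro n hn h
      by_cases h' : ∀ a, S.x a • n ∈ D
      · exact ⟨n, hn, h'⟩
      · push Not at h'
        obtain ⟨a, ha⟩ := h'
        refine ih _ ha fun l hl => ?_
        simpa [mul_smul] using h (l ++ [a]) (by simp [hl])
  obtain ⟨y, hy, hy'⟩ := key m n hn fun l hl => by simp [hm l hl]
  obtain ⟨v, hv⟩ : ∃ v, S.e v • y ∉ D := by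
    by_contra! hc
    exact hy (S.sum_e_smul y ▸ D.sum_mem fun v _ => hc v)
  refine ⟨v, S.e v • y, S.e_smul_e_smul v y, hv, fun a => ?_⟩
  by_cases h : S.src a = v
  · subst h
    rw [S.x_smul_e_smul]
    exact hy' a
  · rw [← mul_smul, S.x_mul_e_of_ne h, zero_smul]
    exact D.zero_mem

/-! ### Injective modules -/

/-- Each g(x_a y) is killed by the arrow that follows a in a relation, so coexactness writes it as
x_a z_a; joint lifting replaces all the z_a by a single c. This c is a consistent value for an
extension of g to y. -/
lemma exists_smul_eq_of_coexactAt {Y : Type*} [AddCommGroup Y] [Module R Y]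
    (h : ∀ a, S.CoexactAt N a) (h' : S.JointImages N) (D : Submodule R Y) (g : D →ₗ[R] N)
    {v : V} {y : Y} (hv : S.e v • y = y) (hy : y ∉ D) (hD : ∀ a, S.x a • y ∈ D) :
    ∃ c : N, ∀ (r : R) (hr : r • y ∈ D), g ⟨r • y, hr⟩ = r • c := by
  have hm : ∀ a, ∃ z : N, g ⟨S.x a • y, hD a⟩ = S.x a • z := fun a => by
    refine h a _ ?_ fun b hb => ?_
    · rw [← map_smul]
      congr 1
      exact Subtype.ext (S.e_smul_x_smul a y)
    · rw [← map_smul, ← map_zero g]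
      congr 1
      exact Subtype.ext (S.rel_smul hb y)
  choose z hz using hm
  obtain ⟨c, hc⟩ := h' z
  have hc' : ∀ a, S.x a • S.e v • c = g ⟨S.x a • y, hD a⟩ := fun a => by
    by_cases ha : S.src a = v
    · subst ha
      rw [S.x_smul_e_smul, hc, hz]
    · rw [← mul_smul, S.x_mul_e_of_ne ha, zero_smul, ← map_zero g]
      congr 1
      refine Subtype.ext ?_
      change 0 = S.x a • y
      rw [← hv, ← mul_smul, S.x_mul_e_of_ne ha, zero_smul]
  refine ⟨S.e v • c, fun r hr => ?_⟩
  obtain ⟨l, w, hw⟩ := S.decomp_left r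
  have hr' : r * S.e v = l v • S.e v + ∑ a, w a * (S.x a * S.e v) := by
    conv_lhs => rw [hw, add_mul, Finset.sum_mul, Finset.sum_mul]
    congr 1
    · rw [Finset.sum_eq_single v (fun u _ hu => ?_) (by simp), smul_mul_assoc, S.e_mul_self]
      rw [smul_mul_assoc, S.e_mul_e _ _ hu, smul_zero]
    · simp_rw [mul_assoc]
  have hl : r • y = (l v • S.e v) • y + ∑ a, w a • S.x a • y := by
    conv_lhs => rw [← hv, ← mul_smul, hr', add_smul, Finset.sum_smul]
    simp_rw [mul_smul, hv]
  have hmem : ∑ a, w a • S.x a • y ∈ D := D.sum_mem fun a _ => D.smul_mem _ (hD a)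
  -- A nonzero coefficient at e_v could be inverted, which would put y itself in D.
  have h0 : l v = 0 := by
    by_contra h0
    have h1 : (l v • S.e v) • y ∈ D := by
      have := D.sub_mem hr hmem
      rwa [hl, add_sub_cancel_right] at this
    apply hy
    have h2 := D.smul_mem ((l v)⁻¹ • S.e v) h1
    rwa [← mul_smul, smul_mul_smul_comm, inv_mul_cancel₀ h0, one_smul, S.e_mul_self, hv] at h2
  have e1 : (⟨r • y, hr⟩ : D) = ∑ a, w a • ⟨S.x a • y, hD a⟩ := by
    refine Subtype.ext ?_
    simp [hl, h0]
  rw [e1, map_sum, ← mul_smul, hr', h0, zero_smul, zero_add, Finset.sum_smul]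
  refine Finset.sum_congr rfl fun a _ => ?_
  rw [map_smul, mul_smul, mul_smul, hc']

/-- A maximal partial extension must be total: outside a proper domain, nilpotence supplies y with
all x_a y in the domain, and the previous lemma extends the map to y. -/
lemma exists_extension_of_coexactAt {Y : Type*} [AddCommGroup Y] [Module R Y]
    (h : ∀ a, S.CoexactAt N a) (h' : S.JointImages N) (p : Y →ₗ.[R] N) :
    ∃ g : Y →ₗ[R] N, ∀ y : p.domain, g y = p y := by
  obtain ⟨m, hpm, hmax⟩ := zorn_le_nonempty₀ (Set.univ : Set (Y →ₗ.[R] N))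
    (fun c _ hc y hy => ⟨LinearPMap.sSup c hc.directedOn, trivial, fun z hz =>
      LinearPMap.le_sSup hc.directedOn hz⟩) p trivial
  have htop : m.domain = ⊤ := by
    by_contra htop
    obtain ⟨n, hn⟩ : ∃ n, n ∉ m.domain := by
      by_contra! hc
      exact htop (eq_top_iff.mpr fun n _ => hc n)
    obtain ⟨v, y, hv, hy, hD⟩ := S.exists_notMem_forall_smul_mem m.domain hn
    obtain ⟨c, hc⟩ := S.exists_smul_eq_of_coexactAt h h' m.domain m.toFun hv hy hD
    let q : Y →ₗ.[R] N := LinearPMap.mkSpanSingleton' y c fun r hr => by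
      have := hc r (by rw [hr]; exact zero_mem _)
      simp only [hr] at this
      exact this.symm.trans (map_zero m.toFun)
    have hq : ∀ (x : m.domain) (z : q.domain), (x : Y) = z → m x = q z := by
      rintro ⟨x, hx⟩ ⟨z, hz⟩ rfl
      obtain ⟨r, rfl⟩ := Submodule.mem_span_singleton.mp hz
      rw [LinearPMap.mkSpanSingleton'_apply]
      exact hc r hx
    have hle := hmax.le_of_ge (y := m.sup q hq) trivial (LinearPMap.left_le_sup _ _ _)
    apply hy
    refine hle.1 ?_
    rw [LinearPMap.domain_sup]
    exact (le_sup_right : q.domain ≤ _) (Submodule.mem_span_singleton_self y)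
  refine ⟨m.toFun ∘ₗ (LinearEquiv.ofTop _ htop).symm.toLinearMap, fun y => ?_⟩
  exact (hpm.2 rfl).symm

end

theorem injective_of_coexactAt {R : Type u} [Ring R] [Algebra k R] (S : MonomialRing k R V Arr)
    (N : Type u) [AddCommGroup N] [Module R N] (h : ∀ a, S.CoexactAt N a) (h' : S.JointImages N) :
    Module.Injective R N := by
  refine Module.Baer.injective fun J g => ?_
  obtain ⟨g', hg'⟩ := S.exists_extension_of_coexactAt h h' (Y := R) ⟨J, g⟩
  exact ⟨g', fun x hx => hg' ⟨x, hx⟩⟩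

section

variable {R : Type u} [Ring R] [Algebra k R] (S : MonomialRing k R V Arr)
variable (E : Type u) [AddCommGroup E] [Module R E] [Module.Injective R E]

/-- A map into an injective module which vanishes on the kernel of `f` factors through `f`. -/
lemma exists_comp_eq_of_ker_le {X : Type*} {Y : Type u} [AddCommGroup X] [AddCommGroup Y]
    [Module R X] [Module R Y] (f : X →ₗ[R] Y) (g : X →ₗ[R] E)
    (h : LinearMap.ker f ≤ LinearMap.ker g) : ∃ φ : Y →ₗ[R] E, ∀ x, φ (f x) = g x := by
  obtain ⟨φ, hφ⟩ := Module.Injective.out (LinearMap.range f).subtype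
    (LinearMap.range f).injective_subtype
    ((LinearMap.ker f).liftQ g h ∘ₗ f.quotKerEquivRange.symm.toLinearMap)
  refine ⟨φ, fun x => ?_⟩
  have := hφ ⟨f x, LinearMap.mem_range_self f x⟩
  rw [Submodule.subtype_apply] at this
  rw [this, LinearMap.comp_apply, LinearEquiv.coe_coe, LinearMap.quotKerEquivRange_symm_apply_image]
  exact Submodule.liftQ_apply _ _ _

/-- By `exact_right`, whatever annihilates x_a from the left also annihilates n. So r x_a ↦ r n is
well defined and extends to R by injectivity; the value at 1 is the required y. -/
theorem coexactAt_of_injective (a : Arr) : S.CoexactAt E a := by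
  intro n hn hb
  obtain ⟨φ, hφ⟩ := exists_comp_eq_of_ker_le (R := R) E (LinearMap.toSpanSingleton R R (S.x a))
    (LinearMap.toSpanSingleton R E n) fun r hr => by
      rw [LinearMap.mem_ker, LinearMap.toSpanSingleton_apply, smul_eq_mul] at hr
      rw [LinearMap.mem_ker, LinearMap.toSpanSingleton_apply, ← hn, ← mul_smul]
      rcases S.exact_right a (r * S.e (S.tgt a)) (by rw [mul_assoc, S.e_mul_self])
        (by rw [mul_assoc, S.e_mul_x, hr]) with h | ⟨b, hab, y, h⟩
      · rw [h, zero_smul]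
      · rw [h, mul_smul, hb b hab, smul_zero]
  refine ⟨φ 1, ?_⟩
  rw [← map_smul, smul_eq_mul, mul_one]
  simpa using (hφ 1).symm

/-- By `indep_right`, Σ r_a x_a ↦ Σ r_a x_a y_a is well defined on the left ideal generated by the
arrows. The value at 1 of an extension to R lifts all the elements at once. -/
theorem jointImages_of_injective : S.JointImages E := by
  intro y
  obtain ⟨φ, hφ⟩ := exists_comp_eq_of_ker_le (R := R) (X := Arr →₀ R) (Y := R) E
    (Finsupp.linearCombination R S.x)
    (Finsupp.linearCombination R fun a => S.x a • y a) fun r hr => by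
      rw [LinearMap.mem_ker, Finsupp.linearCombination_apply, Finsupp.sum_fintype _ _ (by simp)]
        at hr ⊢
      refine Finset.sum_eq_zero fun a _ => ?_
      rw [← mul_smul, S.indep_right r hr a, zero_smul]
  refine ⟨φ 1, fun a => ?_⟩
  rw [← map_smul, smul_eq_mul, mul_one]
  simpa using hφ (Finsupp.single a 1)

end

end MonomialRing

namespace MonomialRing

variable {k R V Arr : Type*} [Field k] [Ring R] [Algebra k R] [Fintype V] [Fintype Arr]
variable (S : MonomialRing k R V Arr)

/-! ### Projective modules -/

section

variable {N : Type*} [AddCommGroup N] [Module R N]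

/-- Exactness of R is applied in each coordinate; uniqueness of the arrow b with `rel b a` lets one
b serve all coordinates. -/
lemma exactAt_finsupp (ι : Type*) (a : Arr) : S.ExactAt (ι →₀ R) a := by
  intro f hf hf0
  have h1 : ∀ i, f i = 0 ∨ ∃ b, S.rel b a ∧ ∃ y, f i = S.x b * y := fun i =>
    S.exact_left a (f i) (DFunLike.congr_fun hf i) (DFunLike.congr_fun hf0 i)
  by_cases hb : ∃ b, S.rel b a
  · obtain ⟨b, hb⟩ := hb
    refine Or.inr ⟨b, hb, ?_⟩
    have h2 : ∀ i, ∃ y, f i = S.x b * y := fun i => by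
      rcases h1 i with h | ⟨c, hc, y, h⟩
      · exact ⟨0, by rw [h, mul_zero]⟩
      · exact ⟨y, by rw [h, S.rel_left_unique hb hc]⟩
    choose y hy using h2
    refine ⟨Finsupp.onFinset f.support (fun i => if f i = 0 then 0 else y i)
      fun i hi => by simp_all, ?_⟩
    ext i
    simp only [Finsupp.smul_apply, Finsupp.onFinset_apply, smul_eq_mul]
    split_ifs with h
    · simp [h]
    · exact hy i
  · refine Or.inl (Finsupp.ext fun i => ?_)
    rcases h1 i with h | ⟨c, hc, -⟩
    · exact h
    · exact absurd ⟨c, hc⟩ hb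

lemma indepImages_finsupp (ι : Type*) : S.IndepImages (ι →₀ R) := by
  intro y hy a
  ext i
  refine S.indep_left (fun a => y a i) ?_ a
  have := DFunLike.congr_fun hy i
  simpa [Finsupp.finsetSum_apply] using this

lemma IndepImages.of_injective {S : MonomialRing k R V Arr} {P : Type*} [AddCommGroup P]
    [Module R P] (h : S.IndepImages P) (f : N →ₗ[R] P) (hf : Function.Injective f) :
    S.IndepImages N := by
  intro y hy a
  apply hf
  rw [map_smul, map_zero]
  refine h (fun a => f (y a)) ?_ a
  rw [← map_zero f, ← hy, map_sum]
  simp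

theorem exactAt_of_projective [Module.Projective R N] (a : Arr) : S.ExactAt N a := by
  obtain ⟨s, hs⟩ := Module.Projective.out (R := R) (P := N)
  intro n hn hn0
  rcases S.exactAt_finsupp N a (s n) (by rw [← map_smul, hn]) (by rw [← map_smul, hn0, map_zero])
    with h | ⟨b, hb, y, h⟩
  · left
    rw [← hs n, h, map_zero]
  · exact Or.inr ⟨b, hb, Finsupp.linearCombination R id y, by rw [← map_smul, ← h, hs n]⟩

theorem indepImages_of_projective [Module.Projective R N] : S.IndepImages N := by
  obtain ⟨s, hs⟩ := Module.Projective.out (R := R) (P := N)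
  exact (S.indepImages_finsupp N).of_injective s hs.injective

/-- The radical of a module. -/
def radical (N : Type*) [AddCommGroup N] [Module R N] [Module k N] [IsScalarTower k R N] :
    Submodule k N where
  carrier := {n | ∃ y : Arr → N, n = ∑ a, S.x a • y a}
  zero_mem' := ⟨0, by simp⟩
  add_mem' := by
    rintro _ _ ⟨y, rfl⟩ ⟨z, rfl⟩
    exact ⟨y + z, by simp [Finset.sum_add_distrib]⟩
  smul_mem' := by
    rintro c _ ⟨y, rfl⟩
    refine ⟨c • y, ?_⟩
    simp only [Finset.smul_sum, Pi.smul_apply]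
    exact Finset.sum_congr rfl fun a _ => (smul_algebra_smul_comm c (S.x a) (y a)).symm

/-- Generators of a projective cover of the module `N`. -/
lemma exists_generators [Module k N] [IsScalarTower k R N] :
    ∃ (B : Set (N ⧸ S.radical N)) (v : B → V) (y : B → N), (∀ b, S.e (v b) • y b = y b) ∧
      (∀ c : B →₀ k, Finsupp.linearCombination k y c ∈ S.radical N → c = 0) ∧
      ∀ n : N, ∃ r : B →₀ R, Finsupp.linearCombination R y r = n := by
  -- The basis of the top is chosen among classes of elements e_v n, so that each generator sits at
  -- a single vertex.
  obtain ⟨B, hB, hspan, hind⟩ := exists_linearIndependent k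
    {q : N ⧸ S.radical N | ∃ (v : V) (n : N), q = (S.radical N).mkQ (S.e v • n)}
  have hz : ∀ m : N, m ∈ S.radical N ↔ (S.radical N).mkQ m = 0 := fun m => by
    rw [← LinearMap.mem_ker, Submodule.ker_mkQ]
  choose v n hn using fun b : B => hB b.2
  have hmk : ∀ b, (S.radical N).mkQ (S.e (v b) • n b) = b := fun b => (hn b).symm
  refine ⟨B, v, fun b => S.e (v b) • n b, fun b => S.e_smul_e_smul _ _, fun c hc => ?_,
    fun m => ?_⟩
  · refine linearIndependent_iff.mp hind c ?_
    rw [hz] at hc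
    rw [← hc, Finsupp.linearCombination_apply, Finsupp.linearCombination_apply, Finsupp.sum,
      Finsupp.sum, map_sum]
    exact Finset.sum_congr rfl fun b _ => by rw [map_smul, hmk]
  · set φ := Finsupp.linearCombination R fun b => S.e (v b) • n b with hφ
    have key : ∀ m : N, ∃ (r : B →₀ R) (z : Arr → N), m = φ r + ∑ a, S.x a • z a := fun m => by
      have hm : (S.radical N).mkQ m ∈ Submodule.span k B := by
        rw [hspan, ← S.sum_e_smul m, map_sum]
        exact Submodule.sum_mem _ fun v _ => Submodule.subset_span ⟨v, m, rfl⟩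
      rw [← Subtype.range_coe (s := B), Finsupp.mem_span_range_iff_exists_finsupp] at hm
      obtain ⟨c, hc⟩ := hm
      refine ⟨c.mapRange (algebraMap k R) (map_zero _), ?_⟩
      have h1 : m - φ (c.mapRange (algebraMap k R) (map_zero _)) ∈ S.radical N := by
        rw [hz, map_sub, ← hc, sub_eq_zero, hφ,
          Finsupp.linearCombination_apply, Finsupp.sum_mapRange_index (by simp), Finsupp.sum,
          Finsupp.sum, map_sum]
        refine Finset.sum_congr rfl fun b _ => ?_
        rw [algebraMap_smul, map_smul, hmk]
      obtain ⟨z, hz⟩ := h1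
      exact ⟨z, by rw [← hz]; abel⟩
    -- The cokernel of φ equals its own radical, hence vanishes by nilpotence; no finiteness of N is
    -- needed.
    have hq : ∀ q : N ⧸ LinearMap.range φ, q = 0 := fun q =>
      S.eq_zero_of_radical_eq Set.univ (fun q _ => by
        obtain ⟨m, rfl⟩ := Submodule.Quotient.mk_surjective _ q
        obtain ⟨r, z, rfl⟩ := key m
        refine ⟨fun a => Submodule.Quotient.mk (z a), fun _ => trivial, ?_⟩
        have h0 : Submodule.Quotient.mk (p := LinearMap.range φ) (φ r) = 0 :=
          (Submodule.Quotient.mk_eq_zero _).mpr ⟨r, rfl⟩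
        rw [Submodule.Quotient.mk_add, h0, zero_add, ← Submodule.mkQ_apply, map_sum]
        rfl) (Set.mem_univ q)
    exact (Submodule.Quotient.mk_eq_zero _).mp (hq (Submodule.Quotient.mk m))

/-- A module is projective if arrows act exactly and with independent images. -/
theorem projective_of_exactAt_of_isScalarTower [Module k N] [IsScalarTower k R N]
    (h : ∀ a, S.ExactAt N a) (h' : S.IndepImages N) : Module.Projective R N := by
  obtain ⟨B, v, y, hy, hind, hgen⟩ := S.exists_generators (N := N)
  set φ := Finsupp.linearCombination R y with hφ
  -- The idempotent ρ projects the free module onto the sum of the R e_{v b}, the projective cover.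
  -- The aim is that φ is injective on its image.
  set ρ : (B →₀ R) →ₗ[R] (B →₀ R) :=
    Finsupp.linearCombination R fun b => Finsupp.single b (S.e (v b)) with hρ
  have hρ_apply : ∀ f b, ρ f b = f b * S.e (v b) := fun f b => by
    rw [hρ, Finsupp.linearCombination_apply, Finsupp.sum, Finsupp.finsetSum_apply,
      Finset.sum_eq_single b]
    · simp
    · intro c _ hc
      simp [hc]
    · intro hb
      simp [Finsupp.notMem_support_iff.mp hb]
  have hφρ : ∀ f, φ (ρ f) = φ f := fun f => by
    rw [← LinearMap.comp_apply]
    congr 1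
    ext b
    simp [hρ, hφ, hy]
  have hρρ : ∀ f, ρ (ρ f) = ρ f := fun f => by
    ext b
    rw [hρ_apply, hρ_apply, mul_assoc, S.e_mul_self]
  -- The kernel of the cover equals its own radical, so nilpotence makes it zero.
  have hK : ∀ f ∈ {f | φ f = 0 ∧ ρ f = f}, ∃ g : Arr → B →₀ R,
      (∀ a, g a ∈ {f | φ f = 0 ∧ ρ f = f}) ∧ f = ∑ a, S.x a • g a := by
    rintro f ⟨hf0, hf⟩
    choose l w hlw using fun b => S.decomp_right (f b)
    let c : B →₀ k := Finsupp.onFinset f.support (fun b => if f b = 0 then 0 else l b (v b))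
      fun b hb => by simp_all
    let g : Arr → B →₀ R := fun a => Finsupp.onFinset f.support
      (fun b => if f b = 0 then 0 else w b a * S.e (v b)) fun b hb => by simp_all
    have hfb : f = ρ (c.mapRange (algebraMap k R) (map_zero _)) + ∑ a, S.x a • g a := by
      ext b
      rw [Finsupp.add_apply, Finsupp.finsetSum_apply, hρ_apply, Finsupp.mapRange_apply]
      simp only [c, g, Finsupp.onFinset_apply, Finsupp.smul_apply, smul_eq_mul]
      split_ifs with h
      · simp [h]
      · have h1 : f b = f b * S.e (v b) := by rw [← hρ_apply, hf]
        rw [h1, hlw b, add_mul, Finset.sum_mul, Finset.sum_mul, Finset.sum_eq_single (v b)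
          (fun u _ hu => by rw [smul_mul_assoc, S.e_mul_e _ _ hu, smul_zero]) (by simp),
          smul_mul_assoc, S.e_mul_self, Algebra.smul_def]
        simp_rw [mul_assoc]
    have hφg : φ f = Finsupp.linearCombination k y c + ∑ a, S.x a • φ (g a) := by
      conv_lhs => rw [hfb, map_add, hφρ, map_sum]
      simp_rw [map_smul]
      congr 1
      rw [hφ, Finsupp.linearCombination_apply, Finsupp.sum_mapRange_index (by simp),
        Finsupp.linearCombination_apply]
      simp_rw [algebraMap_smul]
    -- Since φ f = 0, the combination of generators with coefficients c lies in the radical, and the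
    -- generators are independent modulo the radical.
    have hc : c = 0 := by
      refine hind c ⟨fun a => -φ (g a), ?_⟩
      rw [hf0] at hφg
      simp only [smul_neg, Finset.sum_neg_distrib]
      exact eq_neg_of_add_eq_zero_left hφg.symm
    have hg0 : ∀ a, S.x a • φ (g a) = 0 := h' _ <| by
      rw [hf0, hc, map_zero, zero_add] at hφg
      exact hφg.symm
    have hfg : f = ∑ a, S.x a • g a := by
      rw [hc, Finsupp.mapRange_zero, map_zero, zero_add] at hfb
      exact hfb
    have hρg : ∀ a, ρ (g a) = g a := fun a => by
      ext b
      rw [hρ_apply]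
      simp only [g, Finsupp.onFinset_apply]
      split_ifs
      · rw [zero_mul]
      · rw [mul_assoc, S.e_mul_self]
    -- Exactness at a gives e φ(g_a) = 0 or x_b n with ba a relation. Subtracting x_b times a lift
    -- of n moves e g_a into the kernel without changing x_a g_a.
    have key : ∀ a, ∃ g' : B →₀ R, (φ g' = 0 ∧ ρ g' = g') ∧ S.x a • g' = S.x a • g a := fun a => by
      rcases h a (S.e (S.src a) • φ (g a)) (S.e_smul_e_smul _ _)
        (by rw [S.x_smul_e_smul, hg0]) with h0 | ⟨b, hb, n, hn⟩
      · exact ⟨S.e (S.src a) • g a, ⟨by rw [map_smul, h0], by rw [map_smul, hρg]⟩,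
          S.x_smul_e_smul _ _⟩
      · obtain ⟨r, rfl⟩ := hgen n
        refine ⟨S.e (S.src a) • g a - S.x b • ρ r, ⟨?_, ?_⟩, ?_⟩
        · rw [map_sub, map_smul, hn, map_smul, hφρ, sub_self]
        · rw [map_sub, map_smul, map_smul, hρg, hρρ]
        · rw [smul_sub, S.rel_smul hb, sub_zero, S.x_smul_e_smul]
    choose g' hg' hgg' using key
    exact ⟨g', hg', hfg.trans (Finset.sum_congr rfl fun a _ => (hgg' a).symm)⟩
  have hker : LinearMap.ker φ ≤ LinearMap.ker ρ := fun f hf =>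
    S.eq_zero_of_radical_eq _ hK ⟨by rw [hφρ]; exact hf, hρρ f⟩
  -- As ρ vanishes on ker φ, it descends to N, and φ ρ = φ makes the descended map a section of φ.
  let s : N →ₗ[R] (B →₀ R) := (LinearMap.ker φ).liftQ ρ hker ∘ₗ
    (φ.quotKerEquivOfSurjective hgen).symm.toLinearMap
  have hs : ∀ f, s (φ f) = ρ f := fun f => by
    have : (φ.quotKerEquivOfSurjective hgen).symm (φ f) = Submodule.Quotient.mk f := by
      rw [LinearEquiv.symm_apply_eq]
      rfl
    simp only [s, LinearMap.comp_apply, LinearEquiv.coe_coe, this]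
    exact Submodule.liftQ_apply _ _ _
  refine Module.Projective.of_split s φ (LinearMap.ext fun n => ?_)
  obtain ⟨f, rfl⟩ := hgen n
  rw [LinearMap.comp_apply, hs, hφρ]
  rfl

theorem projective_of_exactAt (h : ∀ a, S.ExactAt N a) (h' : S.IndepImages N) :
    Module.Projective R N :=
  letI : Module k N := Module.compHom N (algebraMap k R)
  haveI : IsScalarTower k R N := ⟨fun c r n => by
    rw [Algebra.smul_def, mul_smul]; rfl⟩
  S.projective_of_exactAt_of_isScalarTower h h'

end

end MonomialRing

/-- There is a chain `r a a₁`, `r a₁ a₂`, … of length `n` starting at `a`. -/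
def HasChain {α : Type*} (r : α → α → Prop) : ℕ → α → Prop
  | 0, _ => True
  | n + 1, a => ∃ b, r a b ∧ HasChain r n b

namespace MonomialRing

section

variable {k R V Arr : Type*} [Field k] [Ring R] [Algebra k R] [Fintype V] [Fintype Arr]
variable {S : MonomialRing k R V Arr}

/-! ### Dimension shifting -/

variable {K P M : Type*} [AddCommGroup K] [AddCommGroup P] [AddCommGroup M]
  [Module R K] [Module R P] [Module R M] {f : K →ₗ[R] P} {g : P →ₗ[R] M}

/-- In P the element is x_b y; the image of y in M is killed by b, so exactness of M at b allows y
to be corrected by a multiple of some x_c with x_b x_c = 0 until it lies in K. -/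
lemma ExactAt.syzygy {a : Arr} (hf : Function.Injective f) (hfg : Function.Exact f g)
    (hg : Function.Surjective g) (hP : S.ExactAt P a) (hM : ∀ b, S.rel b a → S.ExactAt M b) :
    S.ExactAt K a := by
  intro n hn hn0
  rcases hP (f n) (by rw [← map_smul, hn]) (by rw [← map_smul, hn0, map_zero]) with
    h | ⟨b, hb, y, h⟩
  · exact Or.inl (hf (by rw [h, map_zero]))
  · refine Or.inr ⟨b, hb, ?_⟩
    rcases hM b hb (g (S.e (S.src b) • y)) (by rw [← map_smul, S.e_smul_e_smul])
      (by rw [← map_smul, S.x_smul_e_smul, ← h, hfg.apply_apply_eq_zero]) with h0 | ⟨c, hc, m, hm⟩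
    · obtain ⟨z, hz⟩ := (hfg _).mp h0
      exact ⟨z, hf (by rw [h, map_smul, hz, S.x_smul_e_smul])⟩
    · obtain ⟨p, rfl⟩ := hg m
      obtain ⟨z, hz⟩ := (hfg (S.e (S.src b) • y - S.x c • p)).mp
        (by rw [map_sub, hm, map_smul, sub_self])
      exact ⟨z, hf (by rw [h, map_smul, hz, smul_sub, S.x_smul_e_smul, S.rel_smul hc, sub_zero])⟩

/-- If y lifts an element killed by a, then x_a y lies in K and is killed by b. Exactness of K at b
gives x_a y = x_a z with z in K, and exactness of P at a applies to y - z. -/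
lemma ExactAt.of_syzygy {a b : Arr} (hfg : Function.Exact f g)
    (hf : Function.Injective f) (hg : Function.Surjective g) (hP : S.ExactAt P a)
    (hab : S.rel a b) (hK : S.ExactAt K b) : S.ExactAt M a := by
  intro m hm hm0
  obtain ⟨y, rfl⟩ := hg m
  have key : ∀ z : K, S.x a • y = S.x a • f z →
      g y = 0 ∨ ∃ b, S.rel b a ∧ ∃ m : M, g y = S.x b • m := fun z hz => by
    have hgz : g (S.e (S.src a) • (y - f z)) = g y := by
      rw [map_smul, map_sub, hfg.apply_apply_eq_zero, sub_zero, hm]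
    rcases hP (S.e (S.src a) • (y - f z)) (S.e_smul_e_smul _ _)
      (by rw [S.x_smul_e_smul, smul_sub, hz, sub_self]) with h | ⟨c, hc, p, h⟩
    · left
      rw [← hgz, h, map_zero]
    · exact Or.inr ⟨c, hc, g p, by rw [← hgz, h, map_smul]⟩
  obtain ⟨z, hz⟩ := (hfg (S.x a • y)).mp (by rw [map_smul, hm0])
  rcases hK z (hf (by rw [map_smul, hz, ← S.rel_vertex hab, S.e_smul_x_smul]))
    (hf (by rw [map_smul, hz, S.rel_smul hab, map_zero])) with h | ⟨c, hc, w, h⟩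
  · exact key 0 (by rw [← hz, h, map_zero, smul_zero])
  · obtain rfl := S.rel_left_unique hab hc
    exact key w (by rw [← hz, h, map_smul])

/-- Dual shift: a lift y has x_b y in K, coexactness of K at b changes y by an element of K so that
b kills it, and P is coexact at a. -/
lemma CoexactAt.cosyzygy {a : Arr} (hfg : Function.Exact f g)
    (hg : Function.Surjective g) (hf : Function.Injective f) (hP : S.CoexactAt P a)
    (hK : ∀ b, S.rel a b → S.CoexactAt K b) : S.CoexactAt M a := by
  intro m hm hm0
  obtain ⟨y, rfl⟩ := hg m
  have hgy : g (S.e (S.tgt a) • y) = g y := by rw [map_smul, hm]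
  by_cases hb : ∃ b, S.rel a b
  · obtain ⟨b, hb⟩ := hb
    obtain ⟨z, hz⟩ := (hfg (S.x b • y)).mp (by rw [map_smul, hm0 b hb])
    obtain ⟨w, hw⟩ := hK b hb z (hf (by rw [map_smul, hz, S.e_smul_x_smul])) fun c hc =>
      hf (by rw [map_smul, hz, S.rel_smul hc, map_zero])
    obtain ⟨p, hp⟩ := hP (S.e (S.tgt a) • (y - f w)) (S.e_smul_e_smul _ _) fun c hc => by
      obtain rfl := S.rel_right_unique hb hc
      rw [S.rel_vertex hb, S.x_smul_e_smul, smul_sub, ← hz, hw, map_smul, sub_self]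
    refine ⟨g p, ?_⟩
    rw [← map_smul, ← hp, map_smul, map_sub, hfg.apply_apply_eq_zero, sub_zero, hm]
  · obtain ⟨p, hp⟩ := hP (S.e (S.tgt a) • y) (S.e_smul_e_smul _ _)
      fun c hc => absurd ⟨c, hc⟩ hb
    exact ⟨g p, by rw [← map_smul, ← hp, hgy]⟩

lemma CoexactAt.of_cosyzygy {a b : Arr} (hfg : Function.Exact f g)
    (hf : Function.Injective f) (hg : Function.Surjective g) (hP : S.CoexactAt P b)
    (hab : S.rel a b) (hM : S.CoexactAt M a) : S.CoexactAt K b := by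
  intro n hn hn0
  obtain ⟨y, hy⟩ := hP (f n) (by rw [← map_smul, hn])
    fun c hc => by rw [← map_smul, hn0 c hc, map_zero]
  obtain ⟨m, hm⟩ := hM (g (S.e (S.src b) • y)) (by
    rw [← map_smul, S.rel_vertex hab, S.e_smul_e_smul]) fun c hc => by
      obtain rfl := S.rel_right_unique hab hc
      rw [← map_smul, S.x_smul_e_smul, ← hy, hfg.apply_apply_eq_zero]
  obtain ⟨p, rfl⟩ := hg m
  obtain ⟨z, hz⟩ := (hfg (S.e (S.src b) • y - S.x a • p)).mp
    (by rw [map_sub, hm, map_smul, sub_self])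
  exact ⟨z, hf (by rw [hy, map_smul, hz, smul_sub, S.x_smul_e_smul, S.rel_smul hab, sub_zero])⟩

lemma JointImages.of_surjective (h : S.JointImages P) (hg : Function.Surjective g) :
    S.JointImages M := by
  intro y
  choose z hz using fun a => hg (y a)
  obtain ⟨c, hc⟩ := h z
  exact ⟨g c, fun a => by rw [← map_smul, hc, map_smul, hz]⟩

end

section

variable {k V Arr : Type*} {R : Type u} [Field k] [Ring R] [Algebra k R] [Fintype V] [Fintype Arr]
variable (S : MonomialRing k R V Arr)

/-! ### Homological dimensions -/

lemma exists_projective_presentation (M : ModuleCat.{u} R) :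
    ∃ T : ShortComplex (ModuleCat.{u} R), T.ShortExact ∧ Projective T.X₂ ∧
      Module.Projective R T.X₂ ∧ T.X₃ = M ∧ Function.Injective T.f.hom ∧
      Function.Exact T.f.hom T.g.hom ∧ Function.Surjective T.g.hom := by
  have h := M.shortExact_projectiveShortComplex
  have hp : Module.Projective R M.projectiveShortComplex.X₂ := inferInstance
  exact ⟨M.projectiveShortComplex, h, (IsProjective.iff_projective _).mp hp, hp, rfl,
    (ModuleCat.mono_iff_injective _).mp h.mono_f,
    (ShortComplex.ShortExact.moduleCat_exact_iff_function_exact _).mp h.exact,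
    (ModuleCat.epi_iff_surjective _).mp h.epi_g⟩

lemma exists_injective_presentation (M : ModuleCat.{u} R) :
    ∃ T : ShortComplex (ModuleCat.{u} R), T.ShortExact ∧ Injective T.X₂ ∧
      Module.Injective R T.X₂ ∧ T.X₁ = M ∧ Function.Injective T.f.hom ∧
      Function.Exact T.f.hom T.g.hom ∧ Function.Surjective T.g.hom := by
  have h : (ShortComplex.mk (Injective.ι M) _ (Limits.cokernel.condition _)).ShortExact :=
    { exact := ShortComplex.exact_cokernel _ }
  have hi : Injective (Injective.under M) := inferInstance
  exact ⟨_, h, hi, (Module.injective_iff_injective_object R _).mpr hi, rfl,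
    (ModuleCat.mono_iff_injective _).mp h.mono_f,
    (ShortComplex.ShortExact.moduleCat_exact_iff_function_exact _).mp h.exact,
    (ModuleCat.epi_iff_surjective _).mp h.epi_g⟩

theorem exactAt_of_hasProjectiveDimensionLT (n : ℕ) : ∀ (M : ModuleCat.{u} R) (a : Arr),
    HasProjectiveDimensionLT M (n + 1) → HasChain S.rel n a → S.ExactAt M a := by
  induction n with
  | zero =>
    intro M a hM _
    have h : Module.Projective R M :=
      (IsProjective.iff_projective (R := R) M).mpr
        (projective_iff_hasProjectiveDimensionLT_one.mpr hM)
    exact S.exactAt_of_projective a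
  | succ n ih =>
    rintro M a hM ⟨b, hab, hb⟩
    obtain ⟨T, hT, hp, hp', rfl, hf, hfg, hg⟩ := exists_projective_presentation M
    exact (S.exactAt_of_projective a).of_syzygy hfg hf hg hab
      (ih _ _ ((hT.hasProjectiveDimensionLT_X₃_iff n hp).mp hM) hb)

/-- Each syzygy shortens by one the chains at whose starting arrows exactness must be assumed. The
induction starts at dimension at most one because `IndepImages` is available for a submodule of a
projective module, but not for M itself. -/
theorem hasProjectiveDimensionLT_of_exactAt (n : ℕ) : ∀ M : ModuleCat.{u} R,
    (∀ a, HasChain S.rel (n + 1) a → S.ExactAt M a) → HasProjectiveDimensionLT M (n + 2) := by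
  induction n with
  | zero =>
    intro M hM
    obtain ⟨T, hT, hp, hp', rfl, hf, hfg, hg⟩ := exists_projective_presentation M
    refine (hT.hasProjectiveDimensionLT_X₃_iff 0 hp).mpr ?_
    have : Module.Projective R T.X₁ := S.projective_of_exactAt
      (fun a => .syzygy hf hfg hg (S.exactAt_of_projective a) fun b hb => hM b ⟨a, hb, trivial⟩)
      (S.indepImages_of_projective.of_injective T.f.hom hf)
    exact projective_iff_hasProjectiveDimensionLT_one.mp
      ((IsProjective.iff_projective (R := R) T.X₁).mp this)
  | succ n ih =>
    intro M hM
    obtain ⟨T, hT, hp, hp', rfl, hf, hfg, hg⟩ := exists_projective_presentation M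
    exact (hT.hasProjectiveDimensionLT_X₃_iff (n + 1) hp).mpr (ih _ fun a ha =>
      .syzygy hf hfg hg (S.exactAt_of_projective a) fun b hb => hM b ⟨a, hb, ha⟩)

theorem coexactAt_of_hasInjectiveDimensionLT (n : ℕ) : ∀ (M : ModuleCat.{u} R) (a : Arr),
    HasInjectiveDimensionLT M (n + 1) → HasChain (fun b c => S.rel c b) n a →
      S.CoexactAt M a := by
  induction n with
  | zero =>
    intro M a hM _
    have h : Module.Injective R M :=
      (Module.injective_iff_injective_object R M).mpr
        (injective_iff_hasInjectiveDimensionLT_one.mpr hM)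
    exact S.coexactAt_of_injective M a
  | succ n ih =>
    rintro M a hM ⟨b, hab, hb⟩
    obtain ⟨T, hT, hp, hp', rfl, hf, hfg, hg⟩ := exists_injective_presentation M
    exact (S.coexactAt_of_injective T.X₂ a).of_cosyzygy hfg hf hg hab
      (ih _ _ ((hT.hasInjectiveDimensionLT_X₃_iff n hp).mpr hM) hb)

/-- Chains now run backwards along relations, and the start at dimension one uses that `JointImages`
passes to quotients of injective modules. -/
theorem hasInjectiveDimensionLT_of_coexactAt (n : ℕ) : ∀ M : ModuleCat.{u} R,
    (∀ a, HasChain (fun b c => S.rel c b) (n + 1) a → S.CoexactAt M a) →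
      HasInjectiveDimensionLT M (n + 2) := by
  induction n with
  | zero =>
    intro M hM
    obtain ⟨T, hT, hp, hp', rfl, hf, hfg, hg⟩ := exists_injective_presentation M
    refine (hT.hasInjectiveDimensionLT_X₃_iff 0 hp).mp ?_
    have : Module.Injective R T.X₃ := S.injective_of_coexactAt _
      (fun a => .cosyzygy hfg hg hf (S.coexactAt_of_injective T.X₂ a)
        fun b hb => hM b ⟨a, hb, trivial⟩)
      ((S.jointImages_of_injective T.X₂).of_surjective hg)
    exact (injective_iff_hasInjectiveDimensionLT_one).mp
      ((Module.injective_iff_injective_object R T.X₃).mp this)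
  | succ n ih =>
    intro M hM
    obtain ⟨T, hT, hp, hp', rfl, hf, hfg, hg⟩ := exists_injective_presentation M
    exact (hT.hasInjectiveDimensionLT_X₃_iff (n + 1) hp).mp (ih _ fun a ha =>
      .cosyzygy hfg hg hf (S.coexactAt_of_injective T.X₂ a) fun b hb => hM b ⟨a, hb, ha⟩)

end

end MonomialRing

/-! ### The bound algebra of a gentle pair -/

section

variable {k V : Type u} [Field k] [Quiver.{u} V]

namespace PathAlgebra

lemma ofPath_mul_arrow {u v w : V} (p : Quiver.Path u v) (e : v ⟶ w) :
    ofPath k ⟨u, v, p⟩ * arrow k ⟨v, w, e⟩ = ofPath k ⟨u, w, p.cons e⟩ := by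
  rw [arrow, ofPath_mul_ofPath]
  simp [pathMul, arrowPath, QPath.comp, Quiver.Hom.toPath]

lemma ofPath_mul_arrow_of_ne (p : QPath V) (a : Total V) (h : p.tgt ≠ a.left) :
    ofPath k p * arrow k a = 0 := by
  exact (ofPath_mul_ofPath _ _).trans (dif_neg h)

lemma ofPath_mul_nil (p : QPath V) (v : V) :
    ofPath k p * ofPath k (QPath.nil v) = if p.tgt = v then ofPath k p else 0 := by
  rw [ofPath_mul_ofPath, pathMul]
  obtain ⟨a, b, p⟩ := p
  by_cases h : b = v
  · subst h
    simp [QPath.nil, QPath.comp]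
  · simp [QPath.nil, h]

lemma nil_mul_ofPath (p : QPath V) (v : V) :
    ofPath k (QPath.nil v) * ofPath k p = if p.src = v then ofPath k p else 0 := by
  rw [ofPath_mul_ofPath, pathMul]
  obtain ⟨a, b, p⟩ := p
  by_cases h : v = a
  · subst h
    simp [QPath.nil, QPath.comp]
  · simp [QPath.nil, h, Ne.symm h]

/-- Remove the last arrow `a` of a path. -/
def stripLastPath (k : Type u) [Field k] (a : Total V) :
    ∀ {u v : V}, Quiver.Path u v → PathAlgebra k V
  | _, _, .nil => 0
  | _, _, .cons p e => if a = ⟨_, _, e⟩ then ofPath k ⟨_, _, p⟩ else 0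

/-- Remove the first arrow `a` of a path. -/
def stripFirstPath (k : Type u) [Field k] [Fintype V] (a : Total V) :
    ∀ {u v : V}, Quiver.Path u v → PathAlgebra k V
  | _, _, .nil => 0
  -- Paths grow at their last arrow, so the first one is reached by recursion; `e` is itself the
  -- first arrow exactly when `p` has length zero.
  | _, _, .cons p e => stripFirstPath k a p * arrow k ⟨_, _, e⟩ +
      if p.length = 0 ∧ a = ⟨_, _, e⟩ then ofPath k (QPath.nil a.right) else 0

/-- The linear extension of `stripLastPath`. -/
def stripLast (a : Total V) : PathAlgebra k V →ₗ[k] PathAlgebra k V :=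
  extend k fun p => stripLastPath k a p.path

/-- A path of positive length ends with an arrow. -/
lemma ofPath_eq_nil_or_mul_arrow (p : QPath V) : (∃ v, p = QPath.nil v) ∨
    ∃ (a : Total V) (q : QPath V), ofPath k p = ofPath k q * arrow k a := by
  obtain ⟨u, v, p⟩ := p
  cases p with
  | nil => exact Or.inl ⟨u, rfl⟩
  | cons p e => exact Or.inr ⟨_, _, (ofPath_mul_arrow p e).symm⟩

lemma nil_mul_nil (v w : V) : ofPath k (QPath.nil v) * ofPath k (QPath.nil w) =
    if v = w then ofPath k (QPath.nil v) else 0 :=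
  ofPath_mul_nil _ _

variable [Fintype V]

/-- The linear extension of `stripFirstPath`. -/
def stripFirst (a : Total V) : PathAlgebra k V →ₗ[k] PathAlgebra k V :=
  extend k fun p => stripFirstPath k a p.path

lemma nil_mul_arrow (a : Total V) (v : V) :
    ofPath k (QPath.nil v) * arrow k a = if a.left = v then arrow k a else 0 :=
  nil_mul_ofPath _ _

lemma arrow_mul_nil (a : Total V) (v : V) :
    arrow k a * ofPath k (QPath.nil v) = if a.right = v then arrow k a else 0 :=
  ofPath_mul_nil _ _

/-- A linear map takes values in a submodule if it does so on paths. -/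
lemma mem_of_forall_ofPath {M : Type*} [AddCommGroup M] [Module k M] (L : PathAlgebra k V →ₗ[k] M)
    (W : Submodule k M) (h : ∀ p, L (ofPath k p) ∈ W) (f : PathAlgebra k V) : L f ∈ W := by
  have : W.mkQ ∘ₗ L = 0 := hom_ext fun p => by simpa using h p
  simpa using LinearMap.congr_fun this f

/-- Stripping reads off the coefficient f of the last arrow; the idempotent remains because only the
paths of f ending at the source of b survive in the product. -/
lemma stripLast_mul_arrow (a b : Total V) (f : PathAlgebra k V) :
    stripLast a (f * arrow k b) =
      if a = b then f * ofPath k (QPath.nil b.left) else 0 := by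
  suffices h : stripLast a ∘ₗ LinearMap.mulRight k (arrow k b) =
      if a = b then LinearMap.mulRight k (ofPath k (QPath.nil b.left)) else 0 by
    have := LinearMap.congr_fun h f
    rw [LinearMap.comp_apply, LinearMap.mulRight_apply] at this
    rw [this]
    split_ifs <;> simp
  refine hom_ext fun p => ?_
  obtain ⟨u, v, p⟩ := p
  obtain ⟨w, z, e⟩ := b
  rw [LinearMap.comp_apply, LinearMap.mulRight_apply]
  by_cases h : v = w
  · subst h
    rw [ofPath_mul_arrow, stripLast, extend_ofPath, stripLastPath]
    split_ifs
    · simp [ofPath_mul_nil]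
    · simp
  · rw [ofPath_mul_arrow_of_ne _ _ h, map_zero]
    split_ifs
    · simp [ofPath_mul_nil, h]
    · simp

lemma stripFirstPath_toPath_comp (a b : Total V) {v : V} (p : Quiver.Path b.right v) :
    stripFirstPath k a (b.hom.toPath.comp p) =
      if a = b then ofPath k ⟨b.right, v, p⟩ else 0 := by
  induction p with
  | nil =>
    rw [Quiver.Path.comp_nil, Quiver.Hom.toPath, stripFirstPath, stripFirstPath]
    simp only [zero_mul, zero_add, Quiver.Path.length_nil, true_and]
    by_cases h : a = b
    · subst h
      simp [QPath.nil]
    · rw [if_neg h, if_neg h]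
  | cons p e ih =>
    have h : ¬((b.hom.toPath.comp p).length = 0 ∧ a = ⟨_, _, e⟩) := by
      simp [Quiver.Path.length_comp]
    rw [Quiver.Path.comp_cons, stripFirstPath, ih, if_neg h, add_zero]
    split_ifs
    · exact ofPath_mul_arrow _ _
    · exact zero_mul _

lemma stripFirst_arrow_mul (a b : Total V) (f : PathAlgebra k V) :
    stripFirst a (arrow k b * f) =
      if a = b then ofPath k (QPath.nil b.right) * f else 0 := by
  suffices h : stripFirst a ∘ₗ LinearMap.mulLeft k (arrow k b) =
      if a = b then LinearMap.mulLeft k (ofPath k (QPath.nil b.right)) else 0 by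
    have := LinearMap.congr_fun h f
    rw [LinearMap.comp_apply, LinearMap.mulLeft_apply] at this
    rw [this]
    split_ifs <;> simp
  refine hom_ext fun p => ?_
  obtain ⟨u, v, p⟩ := p
  rw [LinearMap.comp_apply, LinearMap.mulLeft_apply, arrow, ofPath_mul_ofPath]
  obtain ⟨w, z, e⟩ := b
  by_cases h : z = u
  · subst h
    have h1 : pathMul k (arrowPath ⟨w, z, e⟩) ⟨z, v, p⟩ = ofPath k ⟨w, v, e.toPath.comp p⟩ :=
      (dif_pos rfl).trans rfl
    rw [h1, stripFirst, extend_ofPath]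
    refine (stripFirstPath_toPath_comp (k := k) a ⟨w, z, e⟩ p).trans ?_
    split_ifs
    · simp [nil_mul_ofPath]
    · simp
  · have h1 : pathMul k (arrowPath ⟨w, z, e⟩) ⟨u, v, p⟩ = 0 := dif_neg h
    rw [h1, map_zero]
    split_ifs
    · simp [nil_mul_ofPath, Ne.symm h]
    · simp

/-- A path of positive length starts with an arrow. -/
lemma ofPath_eq_nil_or_arrow_mul (p : QPath V) : (∃ v, p = QPath.nil v) ∨
    ∃ (a : Total V) (f : PathAlgebra k V), ofPath k p = arrow k a * f := by
  obtain ⟨u, v, p⟩ := p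
  induction p with
  | nil => exact Or.inl ⟨u, rfl⟩
  | cons p e ih =>
    right
    rw [← ofPath_mul_arrow]
    rcases ih with ⟨w, h⟩ | ⟨a, f, h⟩
    · cases h
      refine ⟨⟨_, _, e⟩, 1, ?_⟩
      rw [mul_one]
      exact (nil_mul_arrow _ _).trans (if_pos rfl)
    · exact ⟨a, f * arrow k _, by rw [h, mul_assoc]⟩

variable [Fintype (Total V)]

lemma exists_decomposition_last (f : PathAlgebra k V) : ∃ (c : V → k) (y : Total V → PathAlgebra k V),
    f = ∑ v, c v • ofPath k (QPath.nil v) + ∑ a, y a * arrow k a := by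
  let W : Submodule k (PathAlgebra k V) := LinearMap.range
    (LinearMap.coprod (Fintype.linearCombination k fun v => ofPath k (QPath.nil v))
      (LinearMap.lsum k (fun _ : Total V => PathAlgebra k V) k
        fun a => LinearMap.mulRight k (arrow k a)))
  have hW : LinearMap.id (R := k) f ∈ W := mem_of_forall_ofPath _ _ (fun p => by
    rcases ofPath_eq_nil_or_mul_arrow (k := k) p with ⟨v, h⟩ | ⟨a, q, h⟩
    · exact ⟨(Pi.single v 1, 0), by simp [h]⟩
    · exact ⟨(0, Pi.single a (ofPath k q)), by simp [h, Pi.single_apply]⟩) f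
  obtain ⟨⟨c, y⟩, h⟩ := hW
  refine ⟨c, y, h.symm.trans ?_⟩
  simp [Fintype.linearCombination_apply]

lemma exists_decomposition_first (f : PathAlgebra k V) :
    ∃ (c : V → k) (y : Total V → PathAlgebra k V),
      f = ∑ v, c v • ofPath k (QPath.nil v) + ∑ a, arrow k a * y a := by
  let W : Submodule k (PathAlgebra k V) := LinearMap.range
    (LinearMap.coprod (Fintype.linearCombination k fun v => ofPath k (QPath.nil v))
      (LinearMap.lsum k (fun _ : Total V => PathAlgebra k V) k
        fun a => LinearMap.mulLeft k (arrow k a)))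
  have hW : LinearMap.id (R := k) f ∈ W := mem_of_forall_ofPath _ _ (fun p => by
    rcases ofPath_eq_nil_or_arrow_mul (k := k) p with ⟨v, h⟩ | ⟨a, q, h⟩
    · exact ⟨(Pi.single v 1, 0), by simp [h]⟩
    · exact ⟨(0, Pi.single a q), by simp [h, Pi.single_apply]⟩) f
  obtain ⟨⟨c, y⟩, h⟩ := hW
  refine ⟨c, y, h.symm.trans ?_⟩
  simp [Fintype.linearCombination_apply]

end PathAlgebra

/-! ### Stripping arrows from elements of the ideal -/

section Ideal

variable [Fintype V]
variable {I : TwoSidedIdeal (PathAlgebra k V)}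

open PathAlgebra

variable (I) in
/-- A two-sided ideal of the path algebra as a subspace. -/
def idealSubmodule : Submodule k (PathAlgebra k V) where
  carrier := {f | f ∈ I}
  add_mem' := I.add_mem
  zero_mem' := I.zero_mem
  smul_mem' c f hf := by
    rw [← one_mul f, ← smul_mul_assoc]
    exact I.mul_mem_left _ _ hf

/-- Membership in an ideal generated by a set, tested by a linear map into a vector space. -/
lemma mem_of_mem_span {G : Set (PathAlgebra k V)} {M : Type*} [AddCommGroup M] [Module k M]
    (L : PathAlgebra k V →ₗ[k] M) (W : Submodule k M)
    (h : ∀ u, ∀ g ∈ G, ∀ w, L (u * g * w) ∈ W) {f : PathAlgebra k V}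
    (hf : f ∈ TwoSidedIdeal.span G) : L f ∈ W := by
  rw [TwoSidedIdeal.mem_span_iff_mem_addSubgroup_closure] at hf
  induction hf using AddSubgroup.closure_induction with
  | mem x hx =>
    obtain ⟨_, ⟨u, -, g, hg, rfl⟩, w, -, rfl⟩ := hx
    exact h u g hg w
  | zero => simp
  | add x y _ _ hx hy => rw [map_add]; exact W.add_mem hx hy
  | neg x _ hx => rw [map_neg]; exact W.neg_mem hx

/-- It suffices to treat u(bc)w with bc a generator and w a path. If w has positive length, the
relation survives the stripping; if w is trivial, only c = a can be stripped, leaving the multiple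
ub of an arrow with ba ∈ I. -/
lemma IsGentlePair.stripLast_mem (hI : IsGentlePair I) (a : Total V) {f : PathAlgebra k V}
    (hf : f ∈ I) : stripLast a f ∈ idealSubmodule I ⊔
      Submodule.span k {g | ∃ b, IsRelation I b a ∧ ∃ h, g = h * arrow k b} := by
  obtain ⟨G, hG, hIG⟩ := hI.generated
  have hGI : ∀ x ∈ G, arrow k x.1 * arrow k x.2 ∈ I := fun x hx => by
    rw [hIG]
    exact TwoSidedIdeal.subset_span ⟨x, hx, rfl⟩
  refine mem_of_mem_span (G := (fun x => arrow k x.1 * arrow k x.2) '' G) _ _ ?_ (hIG ▸ hf)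
  rintro u _ ⟨x, hx, rfl⟩ w
  refine mem_of_forall_ofPath (stripLast a ∘ₗ
    LinearMap.mulLeft k (u * (arrow k x.1 * arrow k x.2))) _ (fun p => ?_) w
  rw [LinearMap.comp_apply, LinearMap.mulLeft_apply]
  rcases ofPath_eq_nil_or_mul_arrow (k := k) p with ⟨v, h⟩ | ⟨b, q, h⟩
  · rw [h, mul_assoc, mul_assoc, arrow_mul_nil]
    split_ifs
    · rw [← mul_assoc, stripLast_mul_arrow]
      split_ifs with h
      · subst h
        rw [mul_assoc, arrow_mul_nil, if_pos (hG x hx)]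
        exact Submodule.mem_sup_right (Submodule.subset_span ⟨_, ⟨hG x hx, hGI x hx⟩, _, rfl⟩)
      · exact Submodule.zero_mem _
    · simp
  · rw [h, ← mul_assoc, stripLast_mul_arrow]
    split_ifs
    · exact Submodule.mem_sup_left (I.mul_mem_right _ _ (I.mul_mem_right _ _
        (I.mul_mem_left _ _ (hGI x hx))))
    · exact Submodule.zero_mem _

lemma IsGentlePair.stripFirst_mem (hI : IsGentlePair I) (a : Total V) {f : PathAlgebra k V}
    (hf : f ∈ I) : stripFirst a f ∈ idealSubmodule I ⊔
      Submodule.span k {g | ∃ b, IsRelation I a b ∧ ∃ h, g = arrow k b * h} := by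
  obtain ⟨G, hG, hIG⟩ := hI.generated
  have hGI : ∀ x ∈ G, arrow k x.1 * arrow k x.2 ∈ I := fun x hx => by
    rw [hIG]
    exact TwoSidedIdeal.subset_span ⟨x, hx, rfl⟩
  refine mem_of_mem_span (G := (fun x => arrow k x.1 * arrow k x.2) '' G) _ _ ?_ (hIG ▸ hf)
  rintro u _ ⟨x, hx, rfl⟩ w
  refine mem_of_forall_ofPath (stripFirst a ∘ₗ LinearMap.mulRight k w ∘ₗ
    LinearMap.mulRight k (arrow k x.1 * arrow k x.2)) _ (fun p => ?_) u
  simp only [LinearMap.comp_apply, LinearMap.mulRight_apply]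
  rcases ofPath_eq_nil_or_arrow_mul (k := k) p with ⟨v, h⟩ | ⟨b, q, h⟩
  · rw [h, ← mul_assoc, nil_mul_arrow]
    split_ifs
    · rw [mul_assoc, stripFirst_arrow_mul]
      split_ifs with h
      · subst h
        rw [← mul_assoc, nil_mul_arrow, if_pos (hG x hx).symm]
        exact Submodule.mem_sup_right (Submodule.subset_span ⟨_, ⟨hG x hx, hGI x hx⟩, _, rfl⟩)
      · exact Submodule.zero_mem _
    · simp
  · rw [h, mul_assoc, mul_assoc, stripFirst_arrow_mul]
    split_ifs
    · exact Submodule.mem_sup_left (I.mul_mem_left _ _ (I.mul_mem_left _ _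
        (I.mul_mem_right _ _ (hGI x hx))))
    · exact Submodule.zero_mem _

end Ideal
end

/-! ### The opposite bound algebra as a monomial ring -/

section

variable {k V : Type u} [Field k] [Quiver.{u} V] [Fintype V] {I : TwoSidedIdeal (PathAlgebra k V)}

open PathAlgebra MulOpposite

variable (I) in
/-- The projection from the path algebra to the bound algebra. -/
def toBound : PathAlgebra k V →+* BoundAlgebra I := I.ringCon.mk'

lemma toBound_surjective : Function.Surjective (toBound I) := I.ringCon.mk'_surjective

lemma toBound_eq_zero_iff {f : PathAlgebra k V} : toBound I f = 0 ↔ f ∈ I := by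
  rw [← map_zero (toBound I)]
  exact (RingCon.eq _).trans ((TwoSidedIdeal.rel_iff I f 0).trans (by rw [sub_zero]))

lemma toBound_smul (c : k) (f : PathAlgebra k V) : toBound I (c • f) = c • toBound I f := rfl

variable (I) in
/-- The trivial path at `v` in the opposite of the bound algebra. -/
def vertexElem (v : V) : (BoundAlgebra I)ᵐᵒᵖ := op (toBound I (ofPath k (QPath.nil v)))

variable (I) in
/-- The arrow `a` in the opposite of the bound algebra. -/
def arrowElem (a : Total V) : (BoundAlgebra I)ᵐᵒᵖ := op (toBound I (arrow k a))

lemma exists_op_toBound (r : (BoundAlgebra I)ᵐᵒᵖ) : ∃ f, r = op (toBound I f) := by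
  obtain ⟨f, hf⟩ := toBound_surjective (unop r)
  exact ⟨f, by rw [hf, op_unop]⟩

/-- Uniqueness of the arrow b with ba ∈ I collapses the span to multiples of one arrow. -/
lemma IsGentlePair.toBound_stripLast (hI : IsGentlePair I) (a : Total V) {f : PathAlgebra k V}
    (hf : f ∈ I) : toBound I (stripLast a f) = 0 ∨
      ∃ b, IsRelation I b a ∧ ∃ h, toBound I (stripLast a f) = h * toBound I (arrow k b) := by
  obtain ⟨g, hg, h, hh, hgh⟩ := Submodule.mem_sup.mp (hI.stripLast_mem a hf)
  have hg0 : toBound I g = 0 := toBound_eq_zero_iff.mpr hg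
  rw [← hgh, map_add, hg0, zero_add]
  clear hgh
  induction hh using Submodule.span_induction with
  | mem x hx =>
    obtain ⟨b, hb, z, rfl⟩ := hx
    exact Or.inr ⟨b, hb, _, map_mul _ _ _⟩
  | zero => exact Or.inl (map_zero _)
  | add x y _ _ hx hy =>
    rw [map_add]
    rcases hx with hx | ⟨b, hb, z, hx⟩
    · rwa [hx, zero_add]
    · rcases hy with hy | ⟨c, hc, w, hy⟩
      · exact Or.inr ⟨b, hb, z, by rw [hx, hy, add_zero]⟩
      · obtain rfl := hI.relation_left _ _ _ hb hc
        exact Or.inr ⟨b, hb, z + w, by rw [hx, hy, add_mul]⟩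
  | smul c x _ hx =>
    rw [toBound_smul]
    rcases hx with hx | ⟨b, hb, z, hx⟩
    · exact Or.inl (by rw [hx, smul_zero])
    · exact Or.inr ⟨b, hb, c • z, by rw [hx, smul_mul_assoc]⟩

lemma IsGentlePair.toBound_stripFirst (hI : IsGentlePair I) (a : Total V) {f : PathAlgebra k V}
    (hf : f ∈ I) : toBound I (stripFirst a f) = 0 ∨
      ∃ b, IsRelation I a b ∧ ∃ h, toBound I (stripFirst a f) = toBound I (arrow k b) * h := by
  obtain ⟨g, hg, h, hh, hgh⟩ := Submodule.mem_sup.mp (hI.stripFirst_mem a hf)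
  have hg0 : toBound I g = 0 := toBound_eq_zero_iff.mpr hg
  rw [← hgh, map_add, hg0, zero_add]
  clear hgh
  induction hh using Submodule.span_induction with
  | mem x hx =>
    obtain ⟨b, hb, z, rfl⟩ := hx
    exact Or.inr ⟨b, hb, _, map_mul _ _ _⟩
  | zero => exact Or.inl (map_zero _)
  | add x y _ _ hx hy =>
    rw [map_add]
    rcases hx with hx | ⟨b, hb, z, hx⟩
    · rwa [hx, zero_add]
    · rcases hy with hy | ⟨c, hc, w, hy⟩
      · exact Or.inr ⟨b, hb, z, by rw [hx, hy, add_zero]⟩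
      · obtain rfl := hI.relation_right _ _ _ hb hc
        exact Or.inr ⟨b, hb, z + w, by rw [hx, hy, mul_add]⟩
  | smul c x _ hx =>
    rw [toBound_smul]
    rcases hx with hx | ⟨b, hb, z, hx⟩
    · exact Or.inl (by rw [hx, smul_zero])
    · exact Or.inr ⟨b, hb, c • z, by rw [hx, mul_smul_comm]⟩

/-- The product of a path with arrows is a path or zero. -/
lemma ofPath_mul_prod_arrow (l : List (Total V)) : ∀ p : QPath V,
    ofPath k p * (l.map (arrow k)).prod = 0 ∨ ∃ q : QPath V, q.length = p.length + l.length ∧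
      ofPath k p * (l.map (arrow k)).prod = ofPath k q := by
  induction l with
  | nil => exact fun p => Or.inr ⟨p, rfl, by simp⟩
  | cons a l ih =>
    rintro ⟨u, v, p⟩
    rw [List.map_cons, List.prod_cons, ← mul_assoc]
    obtain ⟨w, z, e⟩ := a
    by_cases h : v = w
    · subst h
      rw [ofPath_mul_arrow]
      refine (ih _).imp_right ?_
      rintro ⟨q, hq, h⟩
      refine ⟨q, ?_, h⟩
      rw [hq]
      simp only [QPath.length, Quiver.Path.length_cons, List.length_cons]
      omega
    · exact Or.inl (by rw [ofPath_mul_arrow_of_ne _ _ h, zero_mul])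

lemma IsGentlePair.exists_prod_arrow_mem (hI : IsGentlePair I) :
    ∃ N : ℕ, ∀ l : List (Total V), l.length = N → (l.map (arrow k)).prod ∈ I := by
  obtain ⟨⟨N, -, hN⟩, -⟩ := hI.admissible
  refine ⟨N, fun l hl => ?_⟩
  rw [← one_mul (List.prod _), one_def, Finset.sum_mul]
  refine (idealSubmodule I).sum_mem fun v _ => ?_
  rcases ofPath_mul_prod_arrow (k := k) l (QPath.nil v) with h | ⟨q, hq, h⟩
  · rw [h]
    exact I.zero_mem
  · rw [h]
    exact hN q (by omega)

variable [Fintype (Total V)]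

/-- The opposite of the bound algebra of a gentle pair as a monomial ring. -/
def monomialRing (hI : IsGentlePair I) : MonomialRing k (BoundAlgebra I)ᵐᵒᵖ V (Total V) where
  src a := a.left
  tgt a := a.right
  e := vertexElem I
  x := arrowElem I
  rel a b := IsRelation I a b
  e_mul_self v := by
    rw [vertexElem, ← op_mul, ← map_mul, nil_mul_nil, if_pos rfl]
  e_mul_e v w h := by
    rw [vertexElem, vertexElem, ← op_mul, ← map_mul, nil_mul_nil, if_neg h.symm, map_zero,
      op_zero]
  sum_e := by
    simp_rw [vertexElem]
    rw [← Finset.op_sum, ← map_sum, ← one_def, map_one, op_one]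
  x_mul_e a := by
    rw [vertexElem, arrowElem, ← op_mul, ← map_mul, nil_mul_arrow, if_pos rfl]
  e_mul_x a := by
    rw [vertexElem, arrowElem, ← op_mul, ← map_mul, arrow_mul_nil, if_pos rfl]
  rel_vertex h := h.1
  rel_mul h := by
    rw [arrowElem, arrowElem, ← op_mul, ← map_mul, toBound_eq_zero_iff.mpr h.2, op_zero]
  rel_left_unique h h' := hI.relation_left _ _ _ h h'
  rel_right_unique h h' := hI.relation_right _ _ _ h h'
  nilpotent := by
    obtain ⟨N, hN⟩ := hI.exists_prod_arrow_mem
    refine ⟨N, fun l hl => ?_⟩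
    have h : (l.map (arrowElem I)).prod = op (toBound I (l.reverse.map (arrow k)).prod) := by
      rw [map_list_prod, op_list_prod, List.map_reverse, List.map_reverse, List.map_reverse,
        List.reverse_reverse, List.map_map, List.map_map]
      rfl
    rw [h, toBound_eq_zero_iff.mpr (hN _ (by simpa using hl)), op_zero]
  decomp_left r := by
    obtain ⟨f, rfl⟩ := exists_op_toBound r
    obtain ⟨c, y, h⟩ := exists_decomposition_first f
    refine ⟨c, fun a => op (toBound I (y a)), ?_⟩
    conv_lhs => rw [h]
    simp [vertexElem, arrowElem, toBound_smul]
  decomp_right r := by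
    obtain ⟨f, rfl⟩ := exists_op_toBound r
    obtain ⟨c, y, h⟩ := exists_decomposition_last f
    refine ⟨c, fun a => op (toBound I (y a)), ?_⟩
    conv_lhs => rw [h]
    simp [vertexElem, arrowElem, toBound_smul]
  -- In the opposite ring x_a r = 0 means fa ∈ I; stripping a recovers f, up to the idempotent,
  -- modulo I.
  exact_left a r hr h0 := by
    obtain ⟨f, rfl⟩ := exists_op_toBound r
    rw [arrowElem, ← op_mul, ← map_mul, op_eq_zero_iff, toBound_eq_zero_iff] at h0
    have h := hI.toBound_stripLast a h0
    rw [stripLast_mul_arrow, if_pos rfl, map_mul] at h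
    rw [vertexElem, ← op_mul] at hr
    rw [op_injective hr] at h
    rcases h with h | ⟨b, hb, y, h⟩
    · exact Or.inl (by rw [h, op_zero])
    · exact Or.inr ⟨b, hb, op y, by rw [h, op_mul]; rfl⟩
  -- Stripping a from Σ f_b b ∈ I isolates f_a, which modulo I is zero or a multiple of an arrow b
  -- with ba ∈ I; either way f_a a ∈ I.
  indep_left y hy a := by
    choose f hf using fun a => exists_op_toBound (y a)
    have h1 : ∀ b, arrowElem I b * y b = op (toBound I (f b * arrow k b)) := fun b => by
      rw [hf, arrowElem, ← op_mul, ← map_mul]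
    simp_rw [h1] at hy ⊢
    rw [← Finset.op_sum, ← map_sum, op_eq_zero_iff, toBound_eq_zero_iff] at hy
    have h := hI.toBound_stripLast a hy
    have h2 : stripLast a (∑ b, f b * arrow k b) = f a * ofPath k (QPath.nil a.left) := by
      simp [stripLast_mul_arrow]
    rw [h2] at h
    have h3 : toBound I (f a * arrow k a) =
        toBound I (f a * ofPath k (QPath.nil a.left)) * toBound I (arrow k a) := by
      rw [← map_mul, mul_assoc, nil_mul_arrow, if_pos rfl]
    rw [h3, op_eq_zero_iff]
    rcases h with h | ⟨b, hb, y, h⟩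
    · rw [h, zero_mul]
    · rw [h, mul_assoc, ← map_mul, toBound_eq_zero_iff.mpr hb.2, mul_zero]
  exact_right a r hr h0 := by
    obtain ⟨f, rfl⟩ := exists_op_toBound r
    rw [arrowElem, ← op_mul, ← map_mul, op_eq_zero_iff, toBound_eq_zero_iff] at h0
    have h := hI.toBound_stripFirst a h0
    rw [stripFirst_arrow_mul, if_pos rfl, map_mul] at h
    rw [vertexElem, ← op_mul] at hr
    rw [op_injective hr] at h
    rcases h with h | ⟨b, hb, y, h⟩
    · exact Or.inl (by rw [h, op_zero])
    · exact Or.inr ⟨b, hb, op y, by rw [h, op_mul]; rfl⟩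
  indep_right y hy a := by
    choose f hf using fun a => exists_op_toBound (y a)
    have h1 : ∀ b, y b * arrowElem I b = op (toBound I (arrow k b * f b)) := fun b => by
      rw [hf, arrowElem, ← op_mul, ← map_mul]
    simp_rw [h1] at hy ⊢
    rw [← Finset.op_sum, ← map_sum, op_eq_zero_iff, toBound_eq_zero_iff] at hy
    have h := hI.toBound_stripFirst a hy
    have h2 : stripFirst a (∑ b, arrow k b * f b) = ofPath k (QPath.nil a.right) * f a := by
      simp [stripFirst_arrow_mul]
    rw [h2] at h
    have h3 : toBound I (arrow k a * f a) =
        toBound I (arrow k a) * toBound I (ofPath k (QPath.nil a.right) * f a) := by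
      rw [← map_mul, ← mul_assoc, arrow_mul_nil, if_pos rfl]
    rw [h3, op_eq_zero_iff]
    rcases h with h | ⟨b, hb, y, h⟩
    · rw [h, mul_zero]
    · rw [h, ← mul_assoc, ← map_mul, toBound_eq_zero_iff.mpr hb.2, zero_mul]

end

/-! ### Letters leaving a vertex of a string -/

section

variable {k V : Type u} [Field k] [Quiver.{u} V]

lemma Letter.inv_inv (x : Letter V) : x.inv.inv = x := by cases x <;> rfl

lemma Letter.src_inv (x : Letter V) : x.inv.src = x.tgt := by cases x <;> rfl

lemma Letter.tgt_inv (x : Letter V) : x.inv.tgt = x.src := by cases x <;> rfl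

/-- The letter `y` leads from the `i`-th vertex of the walk `w` to a neighbouring vertex. -/
def LeavesAt (w : List (Letter V)) (i : ℕ) (y : Letter V) : Prop :=
  w[i]? = some y ∨ ∃ j, i = j + 1 ∧ w[j]? = some y.inv

/-- The vertex with number `i` is an end of the walk `w`, and the letter `y` leads from there into
the walk. -/
def IsEnd (w : List (Letter V)) (i : ℕ) (y : Letter V) : Prop :=
  (i = 0 ∧ w.head? = some y) ∨ (i = w.length ∧ w.getLast? = some y.inv)

lemma Moves.leavesAt_pos {w : List (Letter V)} {a : Total V} {i j : ℕ} (h : Moves w a i j) :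
    LeavesAt w i (.pos a) := by
  rcases h with ⟨-, h⟩ | ⟨h', h⟩
  · exact Or.inl h
  · exact Or.inr ⟨j, h', h⟩

lemma Moves.leavesAt_neg {w : List (Letter V)} {a : Total V} {i j : ℕ} (h : Moves w a i j) :
    LeavesAt w j (.neg a) := by
  rcases h with ⟨h', h⟩ | ⟨-, h⟩
  · exact Or.inr ⟨i, h', h⟩
  · exact Or.inl h

lemma LeavesAt.exists_moves_from {w : List (Letter V)} {a : Total V} {i : Fin (w.length + 1)}
    (h : LeavesAt w i (.pos a)) : ∃ j : Fin (w.length + 1), Moves w a i j := by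
  rcases h with h | ⟨j, hj, h⟩
  · obtain ⟨h', -⟩ := List.getElem?_eq_some_iff.mp h
    exact ⟨⟨i + 1, by omega⟩, Or.inl ⟨rfl, h⟩⟩
  · exact ⟨⟨j, by omega⟩, Or.inr ⟨hj, h⟩⟩

lemma LeavesAt.exists_moves_to {w : List (Letter V)} {a : Total V} {i : Fin (w.length + 1)}
    (h : LeavesAt w i (.neg a)) : ∃ j : Fin (w.length + 1), Moves w a j i := by
  rcases h with h | ⟨j, hj, h⟩
  · obtain ⟨h', -⟩ := List.getElem?_eq_some_iff.mp h
    exact ⟨⟨i + 1, by omega⟩, Or.inr ⟨rfl, h⟩⟩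
  · exact ⟨⟨j, by omega⟩, Or.inl ⟨hj, h⟩⟩

lemma IsEnd.leavesAt {w : List (Letter V)} {i : ℕ} {y : Letter V} (h : IsEnd w i y) :
    LeavesAt w i y := by
  rcases h with ⟨rfl, h⟩ | ⟨rfl, h⟩
  · rw [List.head?_eq_getElem?] at h
    exact Or.inl h
  · have h0 : w ≠ [] := by
      rintro rfl
      simp at h
    have := List.length_pos_iff.mpr h0
    rw [List.getLast?_eq_getElem?] at h
    exact Or.inr ⟨w.length - 1, by omega, h⟩

lemma IsEnd.eq_of_leavesAt {w : List (Letter V)} {i : ℕ} {y z : Letter V} (h : IsEnd w i y)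
    (hz : LeavesAt w i z) : z = y := by
  rcases h with ⟨rfl, h⟩ | ⟨rfl, h⟩
  · rcases hz with hz | ⟨j, hj, -⟩
    · rw [List.head?_eq_getElem?, hz] at h
      exact Option.some.inj h
    · omega
  · rcases hz with hz | ⟨j, hj, hz⟩
    · simp at hz
    · rw [List.getLast?_eq_getElem?, show w.length - 1 = j by omega, hz] at h
      rw [← z.inv_inv, Option.some.inj h, y.inv_inv]

lemma IsEnd.eq_or_eq {w : List (Letter V)} {i : ℕ} {x y z : Letter V} (h : IsEnd w i x)
    (hy : w.head? = some y) (hz : w.getLast? = some z.inv) : x = y ∨ x = z := by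
  rcases h with ⟨-, h⟩ | ⟨-, h⟩
  · exact Or.inl (Option.some.inj (h.symm.trans hy))
  · right
    rw [← x.inv_inv, Option.some.inj (h.symm.trans hz), z.inv_inv]

variable [Fintype V] {I : TwoSidedIdeal (PathAlgebra k V)}

lemma IsStep.symm {x y : Letter V} (h : IsStep I x y) : IsStep I y.inv x.inv := by
  obtain ⟨h1, h2, h3⟩ := h
  refine ⟨by rw [y.tgt_inv, x.src_inv, h1], ?_, ?_⟩
  · cases x <;> cases y <;> exact h2
  · rw [y.inv_inv]
    exact fun h => h3 h.symm

/-- No three letters at a vertex form strings pairwise. -/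
lemma IsGentlePair.not_isStep_of_isStep (hI : IsGentlePair I) {x y z : Letter V}
    (h1 : IsStep I x y) (h2 : IsStep I x z) : ¬ IsStep I y.inv z := by
  have h3 (T : Set (Total V)) (hT : T.encard ≤ 2) {a b c : Total V} (ha : a ∈ T) (hb : b ∈ T)
      (hc : c ∈ T) (hab : b ≠ a) (hac : c ≠ a) (hbc : c ≠ b) : False := by
    have h4 : ({a, b, c} : Set (Total V)).encard = 3 :=
      Set.encard_eq_three.mpr ⟨a, b, c, hab.symm, hac.symm, hbc.symm, rfl⟩
    have h5 : ({a, b, c} : Set (Total V)) ⊆ T := by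
      rintro _ (rfl | rfl | rfl) <;> assumption
    have := (Set.encard_le_encard h5).trans hT
    rw [h4] at this
    exact absurd this (by decide)
  rintro h
  obtain ⟨e1, r1, n1⟩ := h1
  obtain ⟨e2, r2, n2⟩ := h2
  obtain ⟨e, r, n⟩ := h
  -- If x⁻¹, y, z have the same orientation, they are three distinct arrows leaving or entering one
  -- vertex. Otherwise two of them meet the third without relation on the same side, and uniqueness
  -- makes those two equal.
  cases x with
  | pos a =>
    cases y with
    | pos c =>
      cases z with
      | pos d => exact n (congrArg _ (hI.nonRelation_right a d c ⟨e2, r2⟩ ⟨e1, r1⟩))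
      | neg d => exact n2 (congrArg _ (hI.nonRelation_left c d a ⟨e.symm, r⟩ ⟨e1, r1⟩))
    | neg c =>
      cases z with
      | pos d => exact n1 (congrArg _ (hI.nonRelation_left d c a ⟨e, r⟩ ⟨e2, r2⟩))
      | neg d =>
        exact h3 _ (hI.in_le_two a.right) rfl e1.symm e2.symm (fun h => n1 (congrArg _ h))
          (fun h => n2 (congrArg _ h)) fun h => n (congrArg _ h)
  | neg a =>
    cases y with
    | pos c =>
      cases z with
      | pos d =>
        exact h3 _ (hI.out_le_two a.left) rfl e1.symm e2.symm (fun h => n1 (congrArg _ h))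
          (fun h => n2 (congrArg _ h)) fun h => n (congrArg _ h)
      | neg d => exact n1 (congrArg _ (hI.nonRelation_right d c a ⟨e.symm, r⟩ ⟨e2.symm, r2⟩))
    | neg c =>
      cases z with
      | pos d => exact n2 (congrArg _ (hI.nonRelation_right c d a ⟨e, r⟩ ⟨e1.symm, r1⟩))
      | neg d => exact n (congrArg _ (hI.nonRelation_left a d c ⟨e2.symm, r2⟩ ⟨e1.symm, r1⟩))

/-- At a given letter, there is at most one arrow which continues it as a string. -/
lemma IsGentlePair.eq_of_isStep_neg (hI : IsGentlePair I) {a b : Total V} {y : Letter V}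
    (ha : IsStep I (.neg a) y) (hb : IsStep I (.neg b) y) : a = b := by
  by_contra h
  refine hI.not_isStep_of_isStep ha.symm hb.symm ⟨ha.1.trans hb.1.symm, trivial, fun h' => h ?_⟩
  exact (Letter.pos.inj h').symm

/-- At a given letter, there is at most one inverse arrow which continues it as a string. -/
lemma IsGentlePair.eq_of_isStep_pos (hI : IsGentlePair I) {a b : Total V} {y : Letter V}
    (ha : IsStep I (.pos a) y) (hb : IsStep I (.pos b) y) : a = b := by
  by_contra h
  refine hI.not_isStep_of_isStep ha.symm hb.symm ⟨ha.1.trans hb.1.symm, trivial, fun h' => h ?_⟩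
  exact (Letter.neg.inj h').symm

namespace GString

variable (s : GString I)

lemma vertexAt_of_leavesAt {i : ℕ} {y : Letter V} (h : LeavesAt s.letters i y) :
    vertexAt s.letters i = some y.src := by
  rcases h with h | ⟨j, rfl, h⟩
  · exact s.vertexAt_src h
  · rw [s.vertexAt_tgt h, y.tgt_inv]

/-- A letter can be continued by all the letters leaving some vertex of a string only at the ends
of the string. -/
lemma exists_leavesAt_not_isStep (hI : IsGentlePair I) {i : Fin (s.letters.length + 1)}
    {x : Letter V} (h : ∀ y, IsEnd s.letters i y → ¬ IsStep I x y) :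
    ∃ y, LeavesAt s.letters i y ∧ ¬ IsStep I x y := by
  have h0 := List.length_pos_iff.mpr s.ne_nil
  obtain ⟨i, hi⟩ := i
  rcases i with _ | i
  · have : IsEnd s.letters 0 s.letters[0] := Or.inl ⟨rfl, by simp [List.head?_eq_getElem?]⟩
    exact ⟨_, this.leavesAt, h _ this⟩
  · have hl : s.letters[i]? = some s.letters[i] := List.getElem?_eq_getElem (by omega)
    have hl' : LeavesAt s.letters (i + 1) s.letters[i].inv :=
      Or.inr ⟨i, rfl, by rw [hl, Letter.inv_inv]⟩
    by_cases hr : i + 1 = s.letters.length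
    · refine ⟨_, hl', h _ (Or.inr ⟨hr, ?_⟩)⟩
      rw [List.getLast?_eq_getElem?, Letter.inv_inv, ← hl]
      congr 1
      omega
    · have hl2 : s.letters[i + 1]? = some s.letters[i + 1] := List.getElem?_eq_getElem (by omega)
      -- At an inner vertex the two leaving letters already form a step with each other, so x cannot
      -- form a step with both.
      by_contra! hc
      refine hI.not_isStep_of_isStep (hc _ hl') (hc _ (Or.inl hl2)) ?_
      rw [Letter.inv_inv]
      exact s.step hl hl2

/-- Two different moves by the same arrow would come from adjacent letters inverse to each other.
Together with the companion on the left, this makes each arrow a partial injection of the basis. -/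
lemma moves_right_unique {a : Total V} {i j l : ℕ} (h : Moves s.letters a i j)
    (h' : Moves s.letters a i l) : j = l := by
  rcases h with ⟨e, h⟩ | ⟨e, h⟩ <;> rcases h' with ⟨e', h'⟩ | ⟨e', h'⟩
  · omega
  · subst e'
    exact absurd rfl (s.step h' h).2.2
  · subst e
    exact absurd rfl (s.step h h').2.2
  · omega

lemma moves_left_unique {a : Total V} {i j l : ℕ} (h : Moves s.letters a j i)
    (h' : Moves s.letters a l i) : j = l := by
  rcases h with ⟨e, h⟩ | ⟨e, h⟩ <;> rcases h' with ⟨e', h'⟩ | ⟨e', h'⟩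
  · omega
  · subst e
    exact absurd rfl (s.step h h').2.2
  · subst e'
    exact absurd rfl (s.step h' h).2.2
  · omega

end GString

end

/-! ### Exactness of string modules -/

section

variable {k V : Type u} [Field k] [Quiver.{u} V]

lemma vertexOp_apply (w : List (Letter V)) (v : V) (n : StringSpace k w)
    (i : Fin (w.length + 1)) : vertexOp k w v n i = if vertexAt w i = some v then n i else 0 := by
  rw [vertexOp, Finsupp.linearCombination_apply, Finsupp.sum_fintype _ _ (by simp),
    Finsupp.finsetSum_apply, Finset.sum_eq_single i]
  · split_ifs <;> simp
  · intro j _ hj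
    split_ifs <;> simp [hj]
  · simp

lemma arrowOp_apply (w : List (Letter V)) (a : Total V) (n : StringSpace k w)
    (j : Fin (w.length + 1)) :
    arrowOp k w a n j = ∑ i : Fin (w.length + 1), if Moves w a i j then n i else 0 := by
  rw [arrowOp, Finsupp.linearCombination_apply, Finsupp.sum_fintype _ _ (by simp),
    Finsupp.finsetSum_apply]
  refine Finset.sum_congr rfl fun i _ => ?_
  rw [Finsupp.smul_apply, Finsupp.finsetSum_apply, Finset.sum_eq_single j]
  · split_ifs <;> simp
  · intro l _ hl
    split_ifs <;> simp [hl]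
  · simp

lemma exists_moves_of_arrowOp_apply_ne_zero {w : List (Letter V)} {a : Total V}
    {n : StringSpace k w} {j : Fin (w.length + 1)} (h : arrowOp k w a n j ≠ 0) :
    ∃ i : Fin (w.length + 1), Moves w a i j := by
  rw [arrowOp_apply] at h
  obtain ⟨i, -, hi⟩ := Finset.exists_ne_zero_of_sum_ne_zero h
  exact ⟨i, by_contra fun h' => hi (if_neg h')⟩

variable [Fintype V] {I : TwoSidedIdeal (PathAlgebra k V)}

lemma eq_inv_or_isRelation_of_not_isStep {x y : Letter V} (hxy : x.tgt = y.src)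
    (h : ¬ IsStep I x y) : y = x.inv ∨ (∃ a b, x = .neg a ∧ y = .neg b ∧ IsRelation I b a) ∨
      ∃ a b, x = .pos a ∧ y = .pos b ∧ IsRelation I a b := by
  by_cases hy : y = x.inv
  · exact Or.inl hy
  · have hr : ¬ NoRelation I x y := fun hr => h ⟨hxy, hr, hy⟩
    cases x with
    | pos a =>
      cases y with
      | pos b => exact Or.inr (Or.inr ⟨a, b, rfl, rfl, hxy, not_not.mp hr⟩)
      | neg b => exact absurd trivial hr
    | neg a =>
      cases y with
      | pos b => exact absurd trivial hr
      | neg b => exact Or.inr (Or.inl ⟨a, b, rfl, rfl, hxy.symm, not_not.mp hr⟩)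

namespace GString

variable (s : GString I)

lemma arrowOp_apply_of_moves {a : Total V} {i j : Fin (s.letters.length + 1)}
    (h : Moves s.letters a i j) (n : StringSpace k s.letters) :
    arrowOp k s.letters a n j = n i := by
  rw [arrowOp_apply, Finset.sum_eq_single i, if_pos h]
  · intro l _ hl
    exact if_neg fun h' => hl (Fin.ext (s.moves_left_unique h' h))
  · simp

lemma arrowOp_single_of_moves {a : Total V} {i j : Fin (s.letters.length + 1)}
    (h : Moves s.letters a i j) (c : k) :
    arrowOp k s.letters a (Finsupp.single i c) = Finsupp.single j c := by
  ext l
  by_cases hl : j = l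
  · subst hl
    rw [s.arrowOp_apply_of_moves h, Finsupp.single_eq_same, Finsupp.single_eq_same]
  · rw [arrowOp_apply, Finsupp.single_eq_of_ne (Ne.symm hl)]
    refine Finset.sum_eq_zero fun t _ => ?_
    by_cases ht : i = t
    · subst ht
      exact if_neg fun h' => hl (Fin.ext (s.moves_right_unique h h'))
    · rw [Finsupp.single_eq_of_ne (Ne.symm ht), ite_self]

lemma arrowOp_single_eq_zero {a : Total V} {i : Fin (s.letters.length + 1)}
    (h : ¬ LeavesAt s.letters i (.pos a)) (c : k) :
    arrowOp k s.letters a (Finsupp.single i c) = 0 := by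
  ext j
  by_contra hj
  obtain ⟨l, hl⟩ := exists_moves_of_arrowOp_apply_ne_zero hj
  rw [s.arrowOp_apply_of_moves hl, Finsupp.zero_apply] at hj
  by_cases hi : i = l
  · subst hi
    exact h hl.leavesAt_pos
  · exact hj (Finsupp.single_eq_of_ne (Ne.symm hi))

lemma mem_range_arrowOp {a : Total V} {n : StringSpace k s.letters}
    (h : ∀ i, n i ≠ 0 → LeavesAt s.letters i (.neg a)) : ∃ z, n = arrowOp k s.letters a z := by
  suffices n ∈ LinearMap.range (arrowOp k s.letters a) from this.imp fun _ h => h.symm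
  rw [← Finsupp.sum_single n]
  refine Submodule.sum_mem _ fun i hi => ?_
  obtain ⟨j, hj⟩ := (h i (Finsupp.mem_support_iff.mp hi)).exists_moves_to
  exact ⟨_, s.arrowOp_single_of_moves hj _⟩

lemma vertexOp_single_of_leavesAt {i : Fin (s.letters.length + 1)} {y : Letter V}
    (h : LeavesAt s.letters i y) :
    vertexOp k s.letters y.src (Finsupp.single i 1) = Finsupp.single i 1 := by
  rw [vertexOp_single, if_pos (s.vertexAt_of_leavesAt h)]

lemma vertexAt_of_vertexOp_eq {v : V} {n : StringSpace k s.letters}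
    (hn : vertexOp k s.letters v n = n) {i : Fin (s.letters.length + 1)} (hi : n i ≠ 0) :
    vertexAt s.letters i = some v := by
  by_contra h
  rw [← hn, vertexOp_apply, if_neg h] at hi
  exact hi rfl

variable (hI : IsGentlePair I)

lemma vertexElem_smul (v : V) (n : s.stringModule hI) :
    vertexElem I v • n = (vertexOp k s.letters v (show StringSpace k s.letters from n) :
      StringSpace k s.letters) := by
  change s.pathAlgebraOp (PathAlgebra.ofPath k (QPath.nil v)) _ = _
  rw [pathAlgebraOp, PathAlgebra.extend_ofPath]
  rfl

lemma arrowElem_smul (a : Total V) (n : s.stringModule hI) :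
    arrowElem I a • n = (arrowOp k s.letters a (show StringSpace k s.letters from n) :
      StringSpace k s.letters) := by
  change s.pathAlgebraOp (arrow k a) _ = _
  rw [arrow, pathAlgebraOp, PathAlgebra.extend_ofPath]
  exact LinearMap.congr_fun (s.arrowOp_mul_vertexOp a) _

variable [Fintype (Total V)]

lemma exactAt_iff (a : Total V) : (monomialRing hI).ExactAt (s.stringModule hI) a ↔
    ∀ n : StringSpace k s.letters, vertexOp k s.letters a.left n = n →
      arrowOp k s.letters a n = 0 → n = 0 ∨ ∃ b, IsRelation I b a ∧
        ∃ z : StringSpace k s.letters, n = arrowOp k s.letters b z := by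
  refine forall_congr' fun n => ?_
  change (vertexElem I a.left • n = n → arrowElem I a • n = 0 → n = 0 ∨ ∃ b, IsRelation I b a ∧
    ∃ z : s.stringModule hI, n = arrowElem I b • z) ↔ _
  simp only [vertexElem_smul, arrowElem_smul]
  rfl

lemma coexactAt_iff (a : Total V) : (monomialRing hI).CoexactAt (s.stringModule hI) a ↔
    ∀ n : StringSpace k s.letters, vertexOp k s.letters a.right n = n →
      (∀ b, IsRelation I a b → arrowOp k s.letters b n = 0) →
        ∃ z : StringSpace k s.letters, n = arrowOp k s.letters a z := by
  refine forall_congr' fun n => ?_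
  change (vertexElem I a.right • n = n → (∀ b, IsRelation I a b → arrowElem I b • n = 0) →
    ∃ z : s.stringModule hI, n = arrowElem I a • z) ↔ _
  simp only [vertexElem_smul, arrowElem_smul]
  rfl

/-- The string module is exact at `a` unless `a⁻¹` can be attached to an end of the string. -/
theorem exactAt_stringModule {a : Total V}
    (h : ∀ i y, IsEnd s.letters i y → ¬ IsStep I (.neg a) y) :
    (monomialRing hI).ExactAt (s.stringModule hI) a := by
  rw [exactAt_iff]
  intro n hv ha
  -- At an index of the support, a does not leave, since a kills n and moves basis vectors
  -- injectively. So the leaving letter that does not continue a⁻¹ must be some b⁻¹ with ba ∈ I,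
  -- which puts the basis vector in the image of b.
  have key : ∀ i, n i ≠ 0 → ∃ b, IsRelation I b a ∧ LeavesAt s.letters i (.neg b) := fun i hi => by
    have hp : ¬ LeavesAt s.letters i (.pos a) := fun hp => by
      obtain ⟨j, hj⟩ := hp.exists_moves_from
      rw [← s.arrowOp_apply_of_moves hj, ha] at hi
      exact hi rfl
    obtain ⟨y, hy, hay⟩ := s.exists_leavesAt_not_isStep hI (h i)
    have hsrc : (Letter.neg a).tgt = y.src :=
      Option.some.inj ((s.vertexAt_of_vertexOp_eq hv hi).symm.trans (s.vertexAt_of_leavesAt hy))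
    rcases eq_inv_or_isRelation_of_not_isStep hsrc hay with rfl | ⟨a', b, h1, rfl, h2⟩ |
      ⟨a', b, h1, -, -⟩
    · exact absurd hy hp
    · obtain rfl := Letter.neg.inj h1
      exact ⟨b, h2, hy⟩
    · cases h1
  by_cases hn : n = 0
  · exact Or.inl hn
  · obtain ⟨i, hi⟩ := DFunLike.ne_iff.mp hn
    obtain ⟨b, hb, -⟩ := key i hi
    refine Or.inr ⟨b, hb, s.mem_range_arrowOp fun j hj => ?_⟩
    obtain ⟨c, hc, hj⟩ := key j hj
    rwa [hI.relation_left _ _ _ hb hc]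

/-- The string module is coexact at `a` unless `a` can be attached to an end of the string. -/
theorem coexactAt_stringModule {a : Total V}
    (h : ∀ i y, IsEnd s.letters i y → ¬ IsStep I (.pos a) y) :
    (monomialRing hI).CoexactAt (s.stringModule hI) a := by
  rw [coexactAt_iff]
  intro n hv hb
  refine s.mem_range_arrowOp fun i hi => ?_
  obtain ⟨y, hy, hay⟩ := s.exists_leavesAt_not_isStep hI (h i)
  have hsrc : (Letter.pos a).tgt = y.src :=
    Option.some.inj ((s.vertexAt_of_vertexOp_eq hv hi).symm.trans (s.vertexAt_of_leavesAt hy))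
  rcases eq_inv_or_isRelation_of_not_isStep hsrc hay with rfl | ⟨a', b, h1, -, -⟩ |
    ⟨a', b, h1, rfl, h2⟩
  · exact hy
  · cases h1
  · obtain rfl := Letter.pos.inj h1
    obtain ⟨j, hj⟩ := hy.exists_moves_from
    rw [← s.arrowOp_apply_of_moves hj, hb b h2] at hi
    exact absurd rfl hi

/-- The basis vector at the end is the witness. Only y leaves there, so a kills it; lying in the
image of b would force y = b⁻¹, and then ba ∈ I contradicts the step from a⁻¹ to y. -/
theorem not_exactAt_stringModule {a : Total V} {i : ℕ} {y : Letter V} (hy : IsEnd s.letters i y)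
    (h : IsStep I (.neg a) y) : ¬ (monomialRing hI).ExactAt (s.stringModule hI) a := by
  obtain ⟨i, rfl⟩ : ∃ j : Fin (s.letters.length + 1), i = j :=
    ⟨⟨i, by rcases hy with ⟨rfl, -⟩ | ⟨rfl, -⟩ <;> omega⟩, rfl⟩
  rw [exactAt_iff]
  intro hex
  have hv := s.vertexOp_single_of_leavesAt hy.leavesAt
  rw [← h.1] at hv
  rcases hex (Finsupp.single i 1) hv (s.arrowOp_single_eq_zero
    (fun hp => h.2.2 (hy.eq_of_leavesAt hp).symm) _) with h0 | ⟨b, hb, z, hz⟩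
  · exact one_ne_zero (Finsupp.single_eq_zero.mp h0)
  · have hz' := DFunLike.congr_fun hz i
    rw [Finsupp.single_eq_same] at hz'
    obtain ⟨j, hj⟩ := exists_moves_of_arrowOp_apply_ne_zero (hz' ▸ one_ne_zero)
    obtain rfl := hy.eq_of_leavesAt hj.leavesAt_neg
    exact h.2.1 hb.2

/-- Again the end vector is the witness: an arrow b with ab ∈ I acting nontrivially would be y, and
lying in the image of a would mean y = a⁻¹; the step excludes both. -/
theorem not_coexactAt_stringModule {a : Total V} {i : ℕ} {y : Letter V} (hy : IsEnd s.letters i y)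
    (h : IsStep I (.pos a) y) : ¬ (monomialRing hI).CoexactAt (s.stringModule hI) a := by
  obtain ⟨i, rfl⟩ : ∃ j : Fin (s.letters.length + 1), i = j :=
    ⟨⟨i, by rcases hy with ⟨rfl, -⟩ | ⟨rfl, -⟩ <;> omega⟩, rfl⟩
  rw [coexactAt_iff]
  intro hex
  have hv := s.vertexOp_single_of_leavesAt hy.leavesAt
  rw [← h.1] at hv
  obtain ⟨z, hz⟩ := hex (Finsupp.single i 1) hv fun b hb =>
    s.arrowOp_single_eq_zero (fun hp => by
      obtain rfl := hy.eq_of_leavesAt hp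
      exact h.2.1 hb.2) _
  have hz' := DFunLike.congr_fun hz i
  rw [Finsupp.single_eq_same] at hz'
  obtain ⟨j, hj⟩ := exists_moves_of_arrowOp_apply_ne_zero (hz' ▸ one_ne_zero)
  exact h.2.2 (hy.eq_of_leavesAt hj.leavesAt_neg).symm

end GString

end

/-! ### Chains of relations -/

section

variable {α : Type*} {r : α → α → Prop}

lemma HasChain.mono {n m : ℕ} (h : m ≤ n) : ∀ {a : α}, HasChain r n a → HasChain r m a := by
  induction n generalizing m with
  | zero =>
    obtain rfl : m = 0 := by omega
    exact fun h => h
  | succ n ih =>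
    rintro a ⟨b, hab, hb⟩
    cases m with
    | zero => trivial
    | succ m => exact ⟨b, hab, ih (by omega) hb⟩

/-- `HasChain` counts relations rather than entries, hence the `- 1`. -/
lemma hasChain_of_isChain {F : List α} (hF : F.IsChain r) {a : α} (ha : F.head? = some a) :
    HasChain r (F.length - 1) a := by
  induction F generalizing a with
  | nil => simp at ha
  | cons b F ih =>
    obtain rfl : b = a := by simpa using ha
    cases F with
    | nil => trivial
    | cons c F =>
      rw [List.isChain_cons_cons] at hF
      exact ⟨c, hF.1, ih hF.2 rfl⟩

/-- Right uniqueness forces every chain from a to follow F, and maximality stops it at the last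
entry. -/
lemma not_hasChain_of_maximal (hr : ∀ {a b c}, r a b → r a c → b = c) {F : List α}
    (hF : F.IsChain r) (hmax : ¬ ∃ b, ∃ a ∈ F.getLast?, r a b) {a : α} (ha : F.head? = some a) :
    ¬ HasChain r F.length a := by
  induction F generalizing a with
  | nil => simp at ha
  | cons b F ih =>
    obtain rfl : b = a := by simpa using ha
    rintro ⟨d, hd, hd'⟩
    cases F with
    | nil => exact hmax ⟨d, b, by simp, hd⟩
    | cons c F =>
      rw [List.isChain_cons_cons] at hF
      obtain rfl := hr hF.1 hd
      exact ih hF.2 (by simpa using hmax) rfl hd'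

end

/-! ### Homological dimensions of string modules -/

section

variable {k V : Type u} [Field k] [Quiver.{u} V] [Fintype V] {I : TwoSidedIdeal (PathAlgebra k V)}

lemma joined_inverseWord_left {F : List (Total V)} {w : List (Letter V)}
    (h : JoinedWithoutRelation I (inverseWord F) w) :
    ∃ f y, F.head? = some f ∧ w.head? = some y ∧ IsStep I (.neg f) y := by
  obtain ⟨x, hx, y, hy, hxy⟩ := h
  rw [inverseWord, List.getLast?_reverse, List.head?_map, Option.mem_map] at hx
  obtain ⟨f, hf, rfl⟩ := hx
  exact ⟨f, y, hf, hy, hxy⟩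

lemma joined_directWord_right {F : List (Total V)} {w : List (Letter V)}
    (h : JoinedWithoutRelation I w (directWord F)) :
    ∃ f y, F.head? = some f ∧ w.getLast? = some y.inv ∧ IsStep I (.neg f) y := by
  obtain ⟨x, hx, y, hy, hxy⟩ := h
  rw [directWord, List.head?_map, Option.mem_map] at hy
  obtain ⟨f, hf, rfl⟩ := hy
  exact ⟨f, x.inv, hf, by rw [x.inv_inv]; exact hx, hxy.symm⟩

lemma joined_directWord_left {F : List (Total V)} {w : List (Letter V)}
    (h : JoinedWithoutRelation I (directWord F) w) :
    ∃ f y, F.reverse.head? = some f ∧ w.head? = some y ∧ IsStep I (.pos f) y := by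
  obtain ⟨x, hx, y, hy, hxy⟩ := h
  rw [directWord, List.getLast?_map, Option.mem_map] at hx
  obtain ⟨f, hf, rfl⟩ := hx
  exact ⟨f, y, by rwa [List.head?_reverse], hy, hxy⟩

lemma joined_inverseWord_right {F : List (Total V)} {w : List (Letter V)}
    (h : JoinedWithoutRelation I w (inverseWord F)) :
    ∃ f y, F.reverse.head? = some f ∧ w.getLast? = some y.inv ∧ IsStep I (.pos f) y := by
  obtain ⟨x, hx, y, hy, hxy⟩ := h
  rw [inverseWord, List.head?_reverse, List.getLast?_map, Option.mem_map] at hy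
  obtain ⟨f, hf, rfl⟩ := hy
  exact ⟨f, x.inv, by rwa [List.head?_reverse], by rw [x.inv_inv]; exact hx,
    hxy.symm⟩

variable (hI : IsGentlePair I) (s : GString I)

lemma IsRightMaximalForbidden.not_hasChain (hI : IsGentlePair I) {F : List (Total V)}
    (hF : IsRightMaximalForbidden I F) {f : Total V} (hf : F.head? = some f) :
    ¬ HasChain (IsRelation I) F.length f :=
  not_hasChain_of_maximal (r := IsRelation I) (fun h h' => hI.relation_right _ _ _ h h')
    hF.1.2 hF.2 hf

lemma IsLeftMaximalForbidden.not_hasChain (hI : IsGentlePair I) {F : List (Total V)}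
    (hF : IsLeftMaximalForbidden I F) {f : Total V} (hf : F.reverse.head? = some f) :
    ¬ HasChain (fun a b => IsRelation I b a) F.length f := by
  rw [← F.length_reverse]
  refine not_hasChain_of_maximal (r := fun a b => IsRelation I b a)
    (fun h h' => hI.relation_left _ _ _ h h') (List.isChain_reverse.mpr hF.1.2) ?_ hf
  rw [List.getLast?_reverse]
  exact hF.2

variable [Finite (Total V)]

/-- A smaller dimension would force exactness at f, the start of `F.length - 1` relations, but f⁻¹
attaches to an end of the string. -/
theorem length_le_projectiveDimension {F : List (Total V)} (hF : IsForbiddenPath I F)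
    {f : Total V} (hf : F.head? = some f) {i : ℕ} {y : Letter V} (hy : IsEnd s.letters i y)
    (h : IsStep I (.neg f) y) : (F.length : WithBot ℕ∞) ≤ projectiveDimension (s.stringModule hI) := by
  have := Fintype.ofFinite (Total V)
  rw [projectiveDimension_ge_iff]
  intro hd
  have hpos := List.length_pos_iff.mpr hF.1
  refine s.not_exactAt_stringModule hI hy h ((monomialRing hI).exactAt_of_hasProjectiveDimensionLT
    (F.length - 1) _ _ ?_ (hasChain_of_isChain hF.2 hf))
  rwa [Nat.sub_add_cancel hpos]

theorem length_le_injectiveDimension {F : List (Total V)} (hF : IsForbiddenPath I F)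
    {f : Total V} (hf : F.reverse.head? = some f) {i : ℕ} {y : Letter V}
    (hy : IsEnd s.letters i y) (h : IsStep I (.pos f) y) :
    (F.length : WithBot ℕ∞) ≤ injectiveDimension (s.stringModule hI) := by
  have := Fintype.ofFinite (Total V)
  rw [injectiveDimension_ge_iff]
  intro hd
  have hpos := List.length_pos_iff.mpr hF.1
  refine s.not_coexactAt_stringModule hI hy h
    ((monomialRing hI).coexactAt_of_hasInjectiveDimensionLT (F.length - 1) _ _ ?_ ?_)
  · rwa [Nat.sub_add_cancel hpos]
  · rw [← F.length_reverse]
    exact hasChain_of_isChain (List.isChain_reverse.mpr hF.2) hf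

/-- Exactness can fail only at arrows whose inverses attach to an end, so only these must be kept
from starting long chains. -/
theorem projectiveDimension_le {n : ℕ} (hn : 0 < n)
    (h : ∀ a i y, IsEnd s.letters i y → IsStep I (.neg a) y → ¬ HasChain (IsRelation I) n a) :
    projectiveDimension (s.stringModule hI) ≤ n := by
  have := Fintype.ofFinite (Total V)
  rw [projectiveDimension_le_iff]
  obtain ⟨n, rfl⟩ := Nat.exists_eq_succ_of_ne_zero hn.ne'
  exact (monomialRing hI).hasProjectiveDimensionLT_of_exactAt n _ fun a ha =>
    s.exactAt_stringModule hI fun i y hy hay => h a i y hy hay ha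

theorem injectiveDimension_le {n : ℕ} (hn : 0 < n)
    (h : ∀ a i y, IsEnd s.letters i y → IsStep I (.pos a) y →
      ¬ HasChain (fun a b => IsRelation I b a) n a) :
    injectiveDimension (s.stringModule hI) ≤ n := by
  have := Fintype.ofFinite (Total V)
  rw [injectiveDimension_le_iff]
  obtain ⟨n, rfl⟩ := Nat.exists_eq_succ_of_ne_zero hn.ne'
  exact (monomialRing hI).hasInjectiveDimensionLT_of_coexactAt n _ fun a ha =>
    s.coexactAt_stringModule hI fun i y hy hay => h a i y hy hay ha

end

end GentleString

end

/-! ### The proposition -/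

open GentleString in
theorem proposition3p2 {k V : Type u} [Field k] [Quiver.{u} V] [Fintype V]
    [∀ a b : V, Finite (a ⟶ b)] (I : TwoSidedIdeal (GentleString.PathAlgebra k V))
    (hI : GentleString.IsGentlePair I) (s : GentleString.GString I) :
    -- left attachment, injective dimension
    (∀ F₁ : List (Quiver.Total V), GentleString.IsLeftMaximalForbidden I F₁ →
      GentleString.JoinedWithoutRelation I (GentleString.directWord F₁) s.letters →
      (F₁.length : WithBot ℕ∞) ≤ injectiveDimension (s.stringModule hI)) ∧
    -- right attachment, injective dimension
    (∀ F₂ : List (Quiver.Total V), GentleString.IsLeftMaximalForbidden I F₂ →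
      GentleString.JoinedWithoutRelation I s.letters (GentleString.inverseWord F₂) →
      (F₂.length : WithBot ℕ∞) ≤ injectiveDimension (s.stringModule hI)) ∧
    -- both attachments, injective dimension
    (∀ F₁ F₂ : List (Quiver.Total V), GentleString.IsLeftMaximalForbidden I F₁ →
      GentleString.JoinedWithoutRelation I (GentleString.directWord F₁) s.letters →
      GentleString.IsLeftMaximalForbidden I F₂ →
      GentleString.JoinedWithoutRelation I s.letters (GentleString.inverseWord F₂) →
      injectiveDimension (s.stringModule hI) =
        ((max F₁.length F₂.length : ℕ) : WithBot ℕ∞)) ∧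
    -- left attachment, projective dimension
    (∀ F₁ : List (Quiver.Total V), GentleString.IsRightMaximalForbidden I F₁ →
      GentleString.JoinedWithoutRelation I (GentleString.inverseWord F₁) s.letters →
      (F₁.length : WithBot ℕ∞) ≤ projectiveDimension (s.stringModule hI)) ∧
    -- right attachment, projective dimension
    (∀ F₂ : List (Quiver.Total V), GentleString.IsRightMaximalForbidden I F₂ →
      GentleString.JoinedWithoutRelation I s.letters (GentleString.directWord F₂) →
      (F₂.length : WithBot ℕ∞) ≤ projectiveDimension (s.stringModule hI)) ∧
    -- both attachments, projective dimension
    (∀ F₁ F₂ : List (Quiver.Total V), GentleString.IsRightMaximalForbidden I F₁ →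
      GentleString.JoinedWithoutRelation I (GentleString.inverseWord F₁) s.letters →
      GentleString.IsRightMaximalForbidden I F₂ →
      GentleString.JoinedWithoutRelation I s.letters (GentleString.directWord F₂) →
      projectiveDimension (s.stringModule hI) =
        ((max F₁.length F₂.length : ℕ) : WithBot ℕ∞)) := by
  have hfin : Finite (Quiver.Total V) :=
    Finite.of_injective (β := Σ a b : V, a ⟶ b) (fun x => ⟨x.left, x.right, x.hom⟩) fun x y h => by
      cases x
      cases y
      cases h
      rfl
  refine ⟨fun F hF h => ?_, fun F hF h => ?_, fun F G hF h hG h' => ?_, fun F hF h => ?_,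
    fun F hF h => ?_, fun F G hF h hG h' => ?_⟩
  · obtain ⟨f, y, hf, hy, hfy⟩ := joined_directWord_left h
    exact length_le_injectiveDimension hI s hF.1 hf (Or.inl ⟨rfl, hy⟩) hfy
  · obtain ⟨f, y, hf, hy, hfy⟩ := joined_inverseWord_right h
    exact length_le_injectiveDimension hI s hF.1 hf (Or.inr ⟨rfl, hy⟩) hfy
  · obtain ⟨f, y, hf, hy, hfy⟩ := joined_directWord_left h
    obtain ⟨g, z, hg, hz, hgz⟩ := joined_inverseWord_right h'
    refine le_antisymm (injectiveDimension_le hI s ?_ fun a i x hx hax ha => ?_) ?_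
    · exact lt_max_of_lt_left (List.length_pos_iff.mpr hF.1.1)
    -- An attachable arrow meets one of the two end letters, where it is the unique such arrow and
    -- hence the last arrow of F or G; left maximality then bounds its chain.
    · rcases hx.eq_or_eq hy hz with rfl | rfl
      · obtain rfl := hI.eq_of_isStep_pos hax hfy
        exact hF.not_hasChain hI hf (ha.mono (le_max_left _ _))
      · obtain rfl := hI.eq_of_isStep_pos hax hgz
        exact hG.not_hasChain hI hg (ha.mono (le_max_right _ _))
    · rcases max_choice F.length G.length with hm | hm <;> rw [hm]
      · exact length_le_injectiveDimension hI s hF.1 hf (Or.inl ⟨rfl, hy⟩) hfy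
      · exact length_le_injectiveDimension hI s hG.1 hg (Or.inr ⟨rfl, hz⟩) hgz
  · obtain ⟨f, y, hf, hy, hfy⟩ := joined_inverseWord_left h
    exact length_le_projectiveDimension hI s hF.1 hf (Or.inl ⟨rfl, hy⟩) hfy
  · obtain ⟨f, y, hf, hy, hfy⟩ := joined_directWord_right h
    exact length_le_projectiveDimension hI s hF.1 hf (Or.inr ⟨rfl, hy⟩) hfy
  · obtain ⟨f, y, hf, hy, hfy⟩ := joined_inverseWord_left h
    obtain ⟨g, z, hg, hz, hgz⟩ := joined_directWord_right h'
    refine le_antisymm (projectiveDimension_le hI s ?_ fun a i x hx hax ha => ?_) ?_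
    · exact lt_max_of_lt_left (List.length_pos_iff.mpr hF.1.1)
    · rcases hx.eq_or_eq hy hz with rfl | rfl
      · obtain rfl := hI.eq_of_isStep_neg hax hfy
        exact hF.not_hasChain hI hf (ha.mono (le_max_left _ _))
      · obtain rfl := hI.eq_of_isStep_neg hax hgz
        exact hG.not_hasChain hI hg (ha.mono (le_max_right _ _))
    · rcases max_choice F.length G.length with hm | hm <;> rw [hm]
      · exact length_le_projectiveDimension hI s hF.1 hf (Or.inl ⟨rfl, hy⟩) hfy
      · exact length_le_projectiveDimension hI s hG.1 hg (Or.inr ⟨rfl, hz⟩) hgz
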